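/- Notation. Let $\mathbb{B}^n$ be the open unit ball of $\mathbb{C}^n$. For a domain (non-empty connected open set) $X\subset\mathbb{C}^n$ let $A^2(X)$ be the Hilbert space of holomorphic functions on $X$ that are square integrable with respect to Lebesgue measure, and let $K_X(z,w)=\sum_j\phi_j(z)\overline{\phi_j(w)}$, for an orthonormal basis $(\phi_j)$ of $A^2(X)$, be the Bergman kernel. If $K_X(z,z)>0$ for all $z\in X$, put $$g_{\mu\nu}(z)=\frac{\partial^2}{\partial z_\mu\,\partial\bar z_\nu}\log K_X(z,z),\qquad b_X(z,\xi)=\Big(\sum_{\mu,\nu=1}^n g_{\mu\nu}(z)\,\xi_\mu\bar\xi_\nu\Big)^{1/2},\qquad d_X(z,w)=\inf_\gamma\int_0^1 b_X(\gamma(t),\dot\gamma(t))\,dt,$$ where the infimum is over all piecewise $C^1$ curves $\gamma:[0,1]\to X$ from $z$ to $w$; $d_X$ is the Bergman pseudodistance. Let $B_X(p,r)=\{w\in X: d_X(p,w)<r\}$. A holomorphic embedding $f:\mathbb{B}^n\to X$ is a holomorphic map with open image that is a biholomorphism onto its image. For $p\in X$ let $\mathcal{R}(p)$ be the set of all $r>0$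 for which there is a holomorphic embedding $f:\mathbb{B}^n\to X$ with $B_X(p,r)\subset f(\mathbb{B}^n)$, and let $h_X(p)=\inf_{r\in\mathcal{R}(p)}\frac1r$ (the Bergman–Fridman invariant). The domain $X$ is taut if every sequence of holomorphic maps from the open unit disc to $X$ has a subsequence that either converges locally uniformly to a holomorphic map from the disc to $X$ or is compactly divergent. Theorem. Let $X\subset\mathbb{C}^n$ be a domain such that $K_X(z,z)>0$ for all $z\in X$ and the Bergman pseudodistance $d_X$ is a distance. Then $\mathcal{R}(x)\neq\emptyset$ for every $x\in X$, so that $h_X$ is a well-defined non-negative real-valued function on $X$, and: (i) If $h_X(x^0)=0$ for some point $x^0\in X$, then $X$ is biholomorphically equivalent to $\mathbb{B}^n$ and $h_X\equiv0$ on $X$. (ii) If $X$ is taut and $h_X(x^0)>0$ for some point $x^0\in X$, then there is a holomorphic embedding $F:\mathbb{B}^n\to X$ such that $B_X\big(x^0,\tfrac{1}{h_X(x^0)}\big)\subset F(\mathbb{B}^n)$. (iii) The function $h_X$ is continuous on $X$. -/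

import Mathlib

open Set Filter Topology MeasureTheory
open scoped ENNReal

noncomputable section

namespace BergmanFridman

/-- The space `ℂⁿ` with its Euclidean norm. -/
abbrev Cn (n : ℕ) : Type := EuclideanSpace ℂ (Fin n)

/-- The open unit ball of `ℂⁿ`. -/
abbrev unitBall (n : ℕ) : Set (Cn n) := Metric.ball 0 1

/-- The Bergman space `A²(X)`: the square integrable holomorphic functions on `X`, as a subspace of
`L²(X)` for Lebesgue measure, with the `L²` inner product. -/
def bergmanSpace {n : ℕ} (X : Set (Cn n)) :
    Submodule ℂ (Lp ℂ 2 ((volume : Measure (Cn n)).restrict X)) where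
  carrier := {f | ∃ g : Cn n → ℂ, DifferentiableOn ℂ g X ∧ f =ᵐ[volume.restrict X] g}
  zero_mem' := ⟨fun _ => 0, differentiableOn_const 0, Lp.coeFn_zero _ _ _⟩
  add_mem' := by
    rintro a b ⟨g, hg, hag⟩ ⟨h, hh, hbh⟩
    exact ⟨g + h, hg.add hh, (Lp.coeFn_add a b).trans (hag.add hbh)⟩
  smul_mem' := by
    rintro c a ⟨g, hg, hag⟩
    exact ⟨c • g, hg.const_smul c, (Lp.coeFn_smul c a).trans (hag.const_smul c)⟩

/-- The holomorphic function on `X` that represents an element of `A²(X)`; for open `X` its values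
at the points of `X` are uniquely determined. -/
def holRep {n : ℕ} {X : Set (Cn n)} (f : bergmanSpace X) : Cn n → ℂ :=
  f.2.choose

/-- An orthonormal basis of the Hilbert space `A²(X)`, that is, a maximal orthonormal set. -/
def bergmanBasis {n : ℕ} (X : Set (Cn n)) : Set (bergmanSpace X) :=
  (exists_maximal_orthonormal (orthonormal_empty ℂ (bergmanSpace X))).choose

/-- The Bergman kernel `K_X(z, w) = ∑ⱼ φⱼ(z) * conj (φⱼ(w))` for an orthonormal basis `(φⱼ)` of
`A²(X)`; it does not depend on the basis. -/
def bergmanKernel {n : ℕ} (X : Set (Cn n)) (z w : Cn n) : ℂ :=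
  ∑' φ : bergmanBasis X, holRep φ.1 z * (starRingEnd ℂ) (holRep φ.1 w)

/-- The Wirtinger derivative `∂u/∂z_μ = (∂u/∂x_μ - i ∂u/∂y_μ) / 2`. -/
def dz {n : ℕ} (μ : Fin n) (u : Cn n → ℂ) (z : Cn n) : ℂ :=
  (fderiv ℝ u z (EuclideanSpace.single μ 1)
    - Complex.I * fderiv ℝ u z (EuclideanSpace.single μ Complex.I)) / 2

/-- The Wirtinger derivative `∂u/∂z̄_μ = (∂u/∂x_μ + i ∂u/∂y_μ) / 2`. -/
def dzbar {n : ℕ} (μ : Fin n) (u : Cn n → ℂ) (z : Cn n) : ℂ :=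
  (fderiv ℝ u z (EuclideanSpace.single μ 1)
    + Complex.I * fderiv ℝ u z (EuclideanSpace.single μ Complex.I)) / 2

/-- The Bergman metric tensor `g_{μν}(z) = ∂²/∂z_μ∂z̄_ν log K_X(z, z)`. -/
def bergmanTensor {n : ℕ} (X : Set (Cn n)) (μ ν : Fin n) (z : Cn n) : ℂ :=
  dz μ (dzbar ν (fun v => ((Real.log (bergmanKernel X v v).re : ℝ) : ℂ))) z

/-- The infinitesimal Bergman pseudometric `b_X(z, ξ) = (∑ g_{μν}(z) ξ_μ conj ξ_ν)^{1/2}`. -/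
def bergmanMetric {n : ℕ} (X : Set (Cn n)) (z ξ : Cn n) : ℝ :=
  Real.sqrt (∑ μ, ∑ ν, bergmanTensor X μ ν z * ξ μ * (starRingEnd ℂ) (ξ ν)).re

/-- `γ` restricts to a piecewise `C¹` curve `[0, 1] → X` from `z` to `w`: it is continuous on
`[0, 1]`, and `C¹` on each closed interval of some partition `0 = t₀ ≤ t₁ ≤ ⋯ ≤ t_k = 1`. -/
structure IsPiecewiseC1Path {n : ℕ} (X : Set (Cn n)) (z w : Cn n) (γ : ℝ → Cn n) : Prop where
  source : γ 0 = z
  target : γ 1 = w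
  mapsTo : MapsTo γ (Icc 0 1) X
  continuousOn : ContinuousOn γ (Icc 0 1)
  piecewise : ∃ (k : ℕ) (t : ℕ → ℝ), Monotone t ∧ t 0 = 0 ∧ t k = 1 ∧
    ∀ i < k, ContDiffOn ℝ 1 γ (Icc (t i) (t (i + 1)))

/-- The Bergman pseudodistance: the infimum of the Bergman lengths of the piecewise `C¹` curves in
`X` that join `z` and `w`. -/
def bergmanDist {n : ℕ} (X : Set (Cn n)) (z w : Cn n) : ℝ :=
  sInf {L | ∃ γ : ℝ → Cn n, IsPiecewiseC1Path X z w γ ∧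
    L = ∫ t in (0 : ℝ)..1, bergmanMetric X (γ t) (deriv γ t)}

/-- The Bergman pseudodistance of `X` is defined (the Bergman kernel is positive on the diagonal)
and is a distance (it separates points). -/
structure BergmanDistIsDistance {n : ℕ} (X : Set (Cn n)) : Prop where
  kernel_pos : ∀ z ∈ X, 0 < (bergmanKernel X z z).re
  separates : ∀ z ∈ X, ∀ w ∈ X, bergmanDist X z w = 0 → z = w

/-- The ball `B_X(p, r)` of the Bergman pseudodistance. -/
def bergmanBall {n : ℕ} (X : Set (Cn n)) (p : Cn n) (r : ℝ) : Set (Cn n) :=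
  {w ∈ X | bergmanDist X p w < r}

/-- `f` is a holomorphic embedding of the open set `U` into `X`: a holomorphic map `U → X` with
open image, which is a biholomorphism onto its image. -/
structure IsHolEmbedding {n : ℕ} (f : Cn n → Cn n) (U X : Set (Cn n)) : Prop where
  holomorphic : DifferentiableOn ℂ f U
  mapsTo : MapsTo f U X
  isOpen_image : IsOpen (f '' U)
  inverse : ∃ g : Cn n → Cn n, DifferentiableOn ℂ g (f '' U) ∧ LeftInvOn g f U

/-- The set `R(p)` of all radii `r > 0` such that `B_X(p, r)` is contained in the image of some
holomorphic embedding of the unit ball into `X`. -/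
def fridmanRadii {n : ℕ} (X : Set (Cn n)) (p : Cn n) : Set ℝ :=
  {r | 0 < r ∧ ∃ f : Cn n → Cn n, IsHolEmbedding f (unitBall n) X ∧
    bergmanBall X p r ⊆ f '' unitBall n}

/-- The Bergman-Fridman invariant `h_X(p)`, the infimum of `1 / r` over `r ∈ R(p)`. -/
def fridmanInvariant {n : ℕ} (X : Set (Cn n)) (p : Cn n) : ℝ :=
  sInf ((fun r : ℝ => 1 / r) '' fridmanRadii X p)

/-- `X` and `Y` are biholomorphically equivalent. -/
def Biholomorphic {n : ℕ} (X Y : Set (Cn n)) : Prop :=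
  ∃ f g : Cn n → Cn n, DifferentiableOn ℂ f X ∧ DifferentiableOn ℂ g Y ∧
    MapsTo f X Y ∧ MapsTo g Y X ∧ InvOn g f X Y

/-- `X` is taut: every sequence of holomorphic maps from the unit disc `Δ` to `X` has a subsequence
that either converges locally uniformly on `Δ` to a holomorphic map `Δ → X`, or is compactly
divergent. -/
def IsTaut {n : ℕ} (X : Set (Cn n)) : Prop :=
  ∀ f : ℕ → ℂ → Cn n,
    (∀ k, DifferentiableOn ℂ (f k) (Metric.ball 0 1) ∧ MapsTo (f k) (Metric.ball 0 1) X) →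
    ∃ s : ℕ → ℕ, StrictMono s ∧
      ((∃ g : ℂ → Cn n, DifferentiableOn ℂ g (Metric.ball 0 1) ∧ MapsTo g (Metric.ball 0 1) X ∧
          TendstoLocallyUniformlyOn (fun k => f (s k)) g atTop (Metric.ball 0 1)) ∨
        (∀ K ⊆ Metric.ball (0 : ℂ) 1, IsCompact K → ∀ L ⊆ X, IsCompact L →
          ∀ᶠ k in atTop, Disjoint (f (s k) '' K) L))

end BergmanFridman

end

open BergmanFridman

/-! The proof is a normal families argument for embeddings of the ball centred at a fixed point `p`.
Since the automorphisms of the ball act transitively, an embedding covering `B_X(p, r)` can be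
normalized to `f_k 0 = p`. The inverses `g_k` then take values in the unit ball and vanish at `p`.
By Montel's theorem they converge, along an ultrafilter, to a holomorphic `G` on every connected
open set containing `p` that the images of the `f_k` exhaust; by the maximum principle `G` maps into
the open ball.

If the invariant vanishes at `p`, the images exhaust `X`. What could fail is that `G` degenerates.
Positivity of the Bergman kernel excludes this: pulling back some `φ` in `A²(X)` with `φ p ≠ 0` and
using the mean value inequality bounds `|det g_k'(p)|` below (`IsBallChart.enorm_sq_mul_volume_le`).
By Hurwitz's theorem `G` is then injective and locally biholomorphic. The self-maps `G ∘ f_k` of the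
ball converge to a map that fixes the image of `G`, hence to the identity, and so `G` is onto
(`exists_isBallChart_univ`).

If the invariant is positive and `X` is taut, the maps `f_k` converge as well: tautness supplies
local bounds and keeps the limit `F` inside `X`. On the Bergman ball of the critical radius `F ∘ G`
is the identity, so `F` covers that ball and is nondegenerate at the centre; Hurwitz's theorem again
gives an embedding (`IsTaut.exists_isHolEmbedding`).

For continuity, the triangle inequality makes `1 / h_X` Lipschitz with constant one for `d_X`
wherever `h_X` is positive (`one_div_fridmanInvariant_le`), and `d_X` is continuous because the
kernel is smooth on the diagonal (`contDiffOn_bergmanKernel`). One zero forces `h_X` to vanish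
identically. -/

namespace BergmanFridman

/-! ### Holomorphic maps of several variables: Cauchy estimates, limits, smoothness. -/

section SeveralVariables

open Metric

variable {E F : Type*} [NormedAddCommGroup E] [NormedSpace ℂ E]
  [NormedAddCommGroup F] [NormedSpace ℂ F]

/-- Cauchy's estimate for the derivative at the centre of a ball. -/
theorem norm_fderiv_le_of_norm_le {f : E → F} {c : E} {R M : ℝ} (hR : 0 < R)
    (hd : DifferentiableOn ℂ f (ball c R)) (hM : ∀ y ∈ ball c R, ‖f y‖ ≤ M) :
    ‖fderiv ℂ f c‖ ≤ 2 * M / R := by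
  refine Complex.norm_fderiv_le_div_of_mapsTo_ball hd (fun y hy => ?_) hR
  rw [mem_closedBall, dist_eq_norm]
  have := norm_sub_le (f y) (f c)
  linarith [hM y hy, hM c (mem_ball_self hR)]

/-- The second order Taylor estimate for a bounded holomorphic map. -/
theorem norm_sub_sub_fderiv_le {f : E → F} {c y : E} {R M : ℝ} (hR : 0 < R)
    (hd : DifferentiableOn ℂ f (ball c R)) (hM : ∀ y ∈ ball c R, ‖f y‖ ≤ M) (hy : y ∈ ball c R) :
    ‖f y - f c - fderiv ℂ f c (y - c)‖ ≤ 4 * M * (‖y - c‖ / R) ^ 2 := by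
  have hfc : HasFDerivAt f (fderiv ℂ f c) c :=
    ((hd c (mem_ball_self hR)).differentiableAt (ball_mem_nhds c hR)).hasFDerivAt
  set h : E → F := fun z => f z - f c - fderiv ℂ f c (z - c) with hh
  have hc : h c = 0 := by simp [hh]
  -- The remainder is at most `2 * M` from the two values plus `2 * M` from Cauchy's bound on the
  -- linear part, and it is `o(z - c)`. The higher order Schwarz lemma with `n = 1` turns this into
  -- a quadratic bound.
  have key := Complex.dist_le_mul_div_pow_of_mapsTo_ball_of_isLittleO (f := h) (c := c) (z := y)
    (R₁ := R) (R₂ := 4 * M) (n := 1) ?_ ?_ ?_ hy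
  · rw [hc, dist_zero_right, dist_eq_norm] at key
    exact key
  · exact (hd.sub_const _).sub
      (((fderiv ℂ f c).differentiable.comp (differentiable_id.sub_const c)).differentiableOn)
  · intro z hz
    rw [hc, mem_closedBall, dist_zero_right]
    have h1 : ‖fderiv ℂ f c (z - c)‖ ≤ 2 * M := by
      refine ((fderiv ℂ f c).le_opNorm _).trans ?_
      have h2 := norm_fderiv_le_of_norm_le hR hd hM
      have h3 : ‖z - c‖ ≤ R := by rw [← dist_eq_norm]; exact (mem_ball.1 hz).le
      calc _ ≤ 2 * M / R * R := mul_le_mul h2 h3 (norm_nonneg _) ((norm_nonneg _).trans h2)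
        _ = 2 * M := by field_simp
    have h4 := norm_sub_le (f z - f c) (fderiv ℂ f c (z - c))
    have h5 := norm_sub_le (f z) (f c)
    linarith [hM z hz, hM c (mem_ball_self hR)]
  · simp only [hc, sub_zero, pow_one]
    exact hfc.isLittleO.norm_right

/-- A uniform limit of holomorphic maps on a ball: the derivatives converge uniformly on the
concentric ball of half the radius. -/
theorem tendstoUniformlyOn_fderiv_ball [CompleteSpace F] {ι : Type*} {l : Filter ι} [l.NeBot]
    {u : ι → E → F} {f : E → F} {c : E} {R : ℝ} (hR : 0 < R)
    (hu : ∀ᶠ k in l, DifferentiableOn ℂ (u k) (ball c R))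
    (h : TendstoUniformlyOn u f l (ball c R)) :
    DifferentiableOn ℂ f (ball c (R / 2)) ∧
      TendstoUniformlyOn (fun k => fderiv ℂ (u k)) (fderiv ℂ f) l (ball c (R / 2)) := by
  have hsub : ∀ y ∈ ball c (R / 2), ball y (R / 2) ⊆ ball c R := fun y hy =>
    ball_subset_ball' (by linarith [mem_ball.1 hy])
  have hC : UniformCauchySeqOn (fun k => fderiv ℂ (u k)) l (ball c (R / 2)) := by
    have h1 := h.uniformCauchySeqOn
    intro w hw
    obtain ⟨ε, hε, hεw⟩ := Metric.mem_uniformity_dist.1 hw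
    -- Cauchy's estimate on balls of radius `R / 2` multiplies the bound by `4 / R`, which leaves `ε
    -- / 2`.
    have h2 := h1 _ (Metric.dist_mem_uniformity (show 0 < ε * R / 8 by positivity))
    filter_upwards [h2, hu.prod_mk hu] with m hm hdm y hy
    apply hεw
    have hd1 := hdm.1.mono (hsub y hy)
    have hd2 := hdm.2.mono (hsub y hy)
    have hR2 : 0 < R / 2 := by positivity
    have hy1 := (hd1 y (mem_ball_self hR2)).differentiableAt (ball_mem_nhds y hR2)
    have hy2 := (hd2 y (mem_ball_self hR2)).differentiableAt (ball_mem_nhds y hR2)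
    have h3 := norm_fderiv_le_of_norm_le (f := u m.1 - u m.2) (M := ε * R / 8) hR2 (hd1.sub hd2)
      (fun z hz => by
        have := hm z (hsub y hy hz)
        simp only [dist_eq_norm] at this
        exact this.le)
    rw [fderiv_sub hy1 hy2] at h3
    rw [dist_eq_norm]
    refine h3.trans_lt ?_
    have : 2 * (ε * R / 8) / (R / 2) = ε / 2 := by field_simp; norm_num
    linarith
  have hlim : ∀ y ∈ ball c (R / 2), ∃ L, Tendsto (fun k => fderiv ℂ (u k) y) l (𝓝 L) := fun y hy =>
    cauchy_map_iff_exists_tendsto.1 (hC.cauchy_map hy)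
  choose! g hg using hlim
  have hT : TendstoUniformlyOn (fun k => fderiv ℂ (u k)) g l (ball c (R / 2)) :=
    hC.tendstoUniformlyOn_of_tendsto hg
  have hD : ∀ y ∈ ball c (R / 2), HasFDerivAt f (g y) y := by
    intro y hy
    have hyR : y ∈ ball c R := ball_subset_ball (by linarith) hy
    refine hasFDerivAt_of_tendstoUniformlyOnFilter (l := l) (f := u)
      (f' := fun k => fderiv ℂ (u k)) ?_ ?_ ?_
    · exact hT.tendstoUniformlyOnFilter.mono_right (le_principal_iff.2 (isOpen_ball.mem_nhds hy))
    · have h1 : ∀ᶠ z in 𝓝 y, z ∈ ball c R := isOpen_ball.mem_nhds hyR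
      filter_upwards [hu.prod_mk h1] with m hm
      exact ((hm.1 _ hm.2).differentiableAt (isOpen_ball.mem_nhds hm.2)).hasFDerivAt
    · filter_upwards [isOpen_ball.mem_nhds hyR] with z hz using h.tendsto_at hz
  refine ⟨fun y hy => (hD y hy).differentiableAt.differentiableWithinAt, ?_⟩
  exact hT.congr_right fun y hy => (hD y hy).fderiv.symm

/-- Near each point of `U`, the maps `u k` are eventually holomorphic. -/
def EventuallyHolomorphicOn {ι : Type*} (l : Filter ι) (u : ι → E → F) (U : Set E) : Prop :=
  ∀ x ∈ U, ∃ δ > 0, ∀ᶠ k in l, DifferentiableOn ℂ (u k) (ball x δ)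

/-- Inverse charts are holomorphic only on varying sets that eventually absorb a neighbourhood of
each point. Shrinking to a single ball reduces locally uniform limits of such maps to the uniform
case above. -/
theorem exists_ball_tendstoUniformlyOn [ProperSpace E] {ι : Type*} {l : Filter ι}
    {u : ι → E → F} {f : E → F} {U : Set E} (hU : IsOpen U)
    (hu : EventuallyHolomorphicOn l u U) (h : TendstoLocallyUniformlyOn u f l U)
    {x : E} (hx : x ∈ U) :
    ∃ R > 0, ball x R ⊆ U ∧ (∀ᶠ k in l, DifferentiableOn ℂ (u k) (ball x R)) ∧
      TendstoUniformlyOn u f l (ball x R) := by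
  obtain ⟨δ, hδ, hd⟩ := hu x hx
  obtain ⟨r, hr, hrU⟩ := Metric.nhds_basis_closedBall.mem_iff.1 (hU.mem_nhds hx)
  have h1 := (tendstoLocallyUniformlyOn_iff_forall_isCompact hU).1 h _ hrU
    (isCompact_closedBall x r)
  refine ⟨min δ r, lt_min hδ hr, ?_, ?_, ?_⟩
  · exact ((ball_subset_ball (min_le_right _ _)).trans ball_subset_closedBall).trans hrU
  · filter_upwards [hd] with k hk using hk.mono (ball_subset_ball (min_le_left _ _))
  · exact h1.mono ((ball_subset_ball (min_le_right _ _)).trans ball_subset_closedBall)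

theorem differentiableOn_of_tendstoLocallyUniformlyOn [ProperSpace E] [CompleteSpace F]
    {ι : Type*} {l : Filter ι} [l.NeBot]
    {u : ι → E → F} {f : E → F} {U : Set E} (hU : IsOpen U)
    (hu : EventuallyHolomorphicOn l u U) (h : TendstoLocallyUniformlyOn u f l U) :
    DifferentiableOn ℂ f U := by
  intro x hx
  obtain ⟨R, hR, -, hd, hT⟩ := exists_ball_tendstoUniformlyOn hU hu h hx
  have hR2 : 0 < R / 2 := by positivity
  exact (((tendstoUniformlyOn_fderiv_ball hR hd hT).1 x (mem_ball_self hR2)).differentiableAt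
    (ball_mem_nhds x hR2)).differentiableWithinAt

theorem tendstoLocallyUniformlyOn_fderiv [ProperSpace E] [CompleteSpace F]
    {ι : Type*} {l : Filter ι} [l.NeBot]
    {u : ι → E → F} {f : E → F} {U : Set E} (hU : IsOpen U)
    (hu : EventuallyHolomorphicOn l u U) (h : TendstoLocallyUniformlyOn u f l U) :
    TendstoLocallyUniformlyOn (fun k => fderiv ℂ (u k)) (fderiv ℂ f) l U := by
  refine tendstoLocallyUniformlyOn_of_forall_exists_nhds fun x hx => ?_
  obtain ⟨R, hR, -, hd, hT⟩ := exists_ball_tendstoUniformlyOn hU hu h hx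
  have hR2 : 0 < R / 2 := by positivity
  exact ⟨_, mem_nhdsWithin_of_mem_nhds (ball_mem_nhds x hR2),
    (tendstoUniformlyOn_fderiv_ball hR hd hT).2⟩

/-- The derivative of a holomorphic map of several variables is holomorphic. -/
theorem differentiableOn_fderiv [FiniteDimensional ℂ E] [CompleteSpace F] {f : E → F}
    {U : Set E} (hU : IsOpen U) (hf : DifferentiableOn ℂ f U) :
    DifferentiableOn ℂ (fderiv ℂ f) U := by
  have hprop : ProperSpace E := FiniteDimensional.proper ℂ E
  have hdir : ∀ v : E, DifferentiableOn ℂ (fun x => fderiv ℂ f x v) U := by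
    intro v x hx
    obtain ⟨r, hr, hrU⟩ := Metric.nhds_basis_closedBall.mem_iff.1 (hU.mem_nhds hx)
    obtain ⟨M, hM⟩ := (isCompact_closedBall x r).exists_bound_of_continuousOn
      (hf.continuousOn.mono hrU)
    have hM0 : 0 ≤ M := (norm_nonneg _).trans (hM x (mem_closedBall_self hr.le))
    have hr2 : 0 < r / 2 := by positivity
    have hsub : ∀ y ∈ ball x (r / 2), ball y (r / 2) ⊆ closedBall x r := fun y hy =>
      (ball_subset_ball' (by linarith [mem_ball.1 hy])).trans ball_subset_closedBall
    -- The difference quotients are holomorphic on a common ball, and by the second order Taylor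
    -- estimate they converge uniformly with error `O(t)`. The directional derivative is thus a
    -- uniform limit of holomorphic maps.
    set q : ℂ → E → F := fun t y => t⁻¹ • (f (y + t • v) - f y) with hq
    have hsmall : ∀ ε > 0, ∀ᶠ t : ℂ in 𝓝[≠] 0, ‖t‖ < ε := fun ε hε =>
      mem_nhdsWithin_of_mem_nhds (by simpa [ball, dist_zero_right] using ball_mem_nhds (0 : ℂ) hε)
    have hv : 0 < ‖v‖ + 1 := by positivity
    have hball : ∀ t : ℂ, ‖t‖ < r / 2 / (‖v‖ + 1) → ∀ y, y + t • v ∈ ball y (r / 2) := by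
      intro t ht y
      rw [mem_ball, dist_eq_norm, add_sub_cancel_left, norm_smul]
      calc ‖t‖ * ‖v‖ ≤ ‖t‖ * (‖v‖ + 1) := by gcongr; linarith
        _ < r / 2 / (‖v‖ + 1) * (‖v‖ + 1) := by gcongr
        _ = r / 2 := by field_simp
    have h1 : ∀ᶠ t in 𝓝[≠] (0 : ℂ), DifferentiableOn ℂ (q t) (ball x (r / 2)) := by
      filter_upwards [hsmall _ (show 0 < r / 2 / (‖v‖ + 1) by positivity)] with t ht
      refine ((hf.comp ((differentiable_id.add_const _).differentiableOn) ?_).sub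
        (hf.mono ?_)).const_smul _
      · intro y hy
        exact hrU (hsub y hy (hball t ht y))
      · intro y hy
        exact hrU (hsub y hy (mem_ball_self hr2))
    have h2 : TendstoUniformlyOn q (fun y => fderiv ℂ f y v) (𝓝[≠] 0) (ball x (r / 2)) := by
      rw [Metric.tendstoUniformlyOn_iff]
      intro ε hε
      have hKpos : 0 < 4 * M * (‖v‖ / (r / 2)) ^ 2 + 1 := by positivity
      filter_upwards [hsmall _ (show 0 < r / 2 / (‖v‖ + 1) by positivity),
        hsmall _ (show 0 < ε / (4 * M * (‖v‖ / (r / 2)) ^ 2 + 1) by positivity),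
        self_mem_nhdsWithin] with t ht ht2 ht0 y hy
      have ht0' : t ≠ 0 := ht0
      have h3 := norm_sub_sub_fderiv_le hr2 (hf.mono ((hsub y hy).trans hrU))
        (fun z hz => hM z (hsub y hy hz)) (hball t ht y)
      rw [add_sub_cancel_left, map_smul] at h3
      have h4 : q t y - fderiv ℂ f y v = t⁻¹ • (f (y + t • v) - f y - t • fderiv ℂ f y v) := by
        simp only [hq, smul_sub, inv_smul_smul₀ ht0']
      rw [dist_comm, dist_eq_norm, h4, norm_smul, norm_inv]
      have htp : 0 < ‖t‖ := norm_pos_iff.2 ht0'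
      have h5 : ‖t‖⁻¹ * (4 * M * (‖t • v‖ / (r / 2)) ^ 2)
          = ‖t‖ * (4 * M * (‖v‖ / (r / 2)) ^ 2) := by
        rw [norm_smul]; field_simp
      calc _ ≤ ‖t‖⁻¹ * (4 * M * (‖t • v‖ / (r / 2)) ^ 2) := by gcongr
        _ = ‖t‖ * (4 * M * (‖v‖ / (r / 2)) ^ 2) := h5
        _ ≤ ‖t‖ * (4 * M * (‖v‖ / (r / 2)) ^ 2 + 1) := by gcongr; linarith
        _ < ε / (4 * M * (‖v‖ / (r / 2)) ^ 2 + 1) * (4 * M * (‖v‖ / (r / 2)) ^ 2 + 1) := by gcongr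
        _ = ε := by field_simp
    have hr4 : 0 < r / 2 / 2 := by positivity
    exact (((tendstoUniformlyOn_fderiv_ball hr2 h1 h2).1 x
      (mem_ball_self hr4)).differentiableAt (ball_mem_nhds x hr4)).differentiableWithinAt
  -- The full derivative is a fixed continuous linear expression in the directional derivatives
  -- along a basis.
  let b := Module.finBasis ℂ E
  have hcoord : ∀ x, fderiv ℂ f x = ∑ i, ContinuousLinearMap.smulRightL ℂ E F
      (LinearMap.toContinuousLinearMap (b.coord i)) (fderiv ℂ f x (b i)) := by
    intro x
    ext v
    conv_lhs => rw [← b.sum_repr v, map_sum]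
    simp
  have : fderiv ℂ f = fun x => ∑ i, ContinuousLinearMap.smulRightL ℂ E F
      (LinearMap.toContinuousLinearMap (b.coord i)) (fderiv ℂ f x (b i)) := funext hcoord
  rw [this]
  refine DifferentiableOn.fun_sum fun i _ => ?_
  exact (ContinuousLinearMap.differentiable _).comp_differentiableOn (hdir (b i))

/-- Holomorphic maps of several variables are smooth. -/
theorem contDiffOn_of_differentiableOn {E F : Type} [NormedAddCommGroup E] [NormedSpace ℂ E]
    [NormedAddCommGroup F] [NormedSpace ℂ F] [FiniteDimensional ℂ E] [CompleteSpace F]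
    {U : Set E} (hU : IsOpen U) {f : E → F} (hf : DifferentiableOn ℂ f U) (m : ℕ) :
    ContDiffOn ℂ m f U := by
  induction m generalizing F with
  | zero => exact contDiffOn_zero.2 hf.continuousOn
  | succ m ih =>
    push_cast
    rw [contDiffOn_succ_iff_fderiv_of_isOpen hU]
    refine ⟨hf, by simp, ih (differentiableOn_fderiv hU hf)⟩

end SeveralVariables

/-! ### Montel, the identity theorem, Hurwitz and the maximum principle. -/

section NormalFamilies

open Metric

theorem one_mem_ball_div {E : Type*} [NormedAddCommGroup E] {c y : E} {R : ℝ} (hy : y ∈ ball c R) (hne : y ≠ c) :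
    (1 : ℂ) ∈ ball (0 : ℂ) (R / ‖y - c‖) := by
  have h0 : 0 < ‖y - c‖ := norm_pos_iff.2 (sub_ne_zero.2 hne)
  rw [mem_ball, dist_zero_right, norm_one, one_lt_div h0, ← dist_eq_norm]
  exact hy

variable {E F : Type*} [NormedAddCommGroup E] [NormedSpace ℂ E]
  [NormedAddCommGroup F] [NormedSpace ℂ F]

/-- Montel's theorem along an ultrafilter. -/
theorem exists_tendstoLocallyUniformlyOn_of_bounded [ProperSpace F] {ι : Type*} (l : Ultrafilter ι)
    {u : ι → E → F} {U : Set E} (hU : IsOpen U)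
    (hb : ∀ x ∈ U, ∃ δ > 0, ∃ M : ℝ, ∀ᶠ k in (l : Filter ι), DifferentiableOn ℂ (u k) (ball x δ) ∧
      ∀ y ∈ ball x δ, ‖u k y‖ ≤ M) :
    ∃ f : E → F, TendstoLocallyUniformlyOn u f l U := by
  -- Along an ultrafilter bounded values in a proper space converge, so pointwise limits exist
  -- everywhere without a diagonal argument.
  have hlim : ∀ x ∈ U, ∃ y : F, Tendsto (fun k => u k x) l (𝓝 y) := by
    intro x hx
    obtain ⟨δ, hδ, M, hM⟩ := hb x hx
    obtain ⟨y, -, hy⟩ := (isCompact_closedBall (0 : F) M).ultrafilter_le_nhds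
      (l.map fun k => u k x) (by
        rw [Ultrafilter.coe_map, le_principal_iff, mem_map]
        filter_upwards [hM] with k hk
        simpa using hk.2 x (mem_ball_self hδ))
    exact ⟨y, hy⟩
  choose! f hf using hlim
  refine ⟨f, ?_⟩
  rw [Metric.tendstoLocallyUniformlyOn_iff]
  intro ε hε x hx
  obtain ⟨δ, hδ, M, hM⟩ := hb x hx
  obtain ⟨r, hr, hrU⟩ := Metric.isOpen_iff.1 hU x hx
  set C := 2 * M / (δ / 2) with hC
  have hδ2 : 0 < δ / 2 := by positivity
  -- Cauchy's estimate gives a Lipschitz constant independent of `k`; this equicontinuity upgrades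
  -- pointwise to locally uniform convergence.
  have hlip : ∀ᶠ k in (l : Filter ι), ∀ y ∈ ball x (δ / 2), ‖u k y - u k x‖ ≤ C * ‖y - x‖ := by
    filter_upwards [hM] with k hk y hy
    have hsub : ∀ z ∈ ball x (δ / 2), ball z (δ / 2) ⊆ ball x δ := fun z hz =>
      ball_subset_ball' (by linarith [mem_ball.1 hz])
    refine (convex_ball x (δ / 2)).norm_image_sub_le_of_norm_fderiv_le (𝕜 := ℂ) (fun z hz => ?_)
      (fun z hz => ?_) (mem_ball_self hδ2) hy
    · have hz' := hsub z hz (mem_ball_self hδ2)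
      exact (hk.1 z hz').differentiableAt (isOpen_ball.mem_nhds hz')
    · exact norm_fderiv_le_of_norm_le hδ2 (hk.1.mono (hsub z hz))
        fun y hy => hk.2 y (hsub z hz hy)
  set ρ := min r (min (δ / 2) (ε / 3 / (|C| + 1))) with hρ
  have hρ0 : 0 < ρ := by positivity
  have hsmall : ∀ y ∈ ball x ρ, C * ‖y - x‖ ≤ ε / 3 := by
    intro y hy
    have h1 : ‖y - x‖ ≤ ε / 3 / (|C| + 1) := by
      rw [← dist_eq_norm]
      exact (mem_ball.1 hy).le.trans ((min_le_right _ _).trans (min_le_right _ _))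
    calc C * ‖y - x‖ ≤ (|C| + 1) * ‖y - x‖ := by
          gcongr; linarith [le_abs_self C]
      _ ≤ (|C| + 1) * (ε / 3 / (|C| + 1)) := by gcongr
      _ = ε / 3 := by field_simp
  have hρr : ball x ρ ⊆ U := (ball_subset_ball (min_le_left _ _)).trans hrU
  have hρδ : ball x ρ ⊆ ball x (δ / 2) :=
    ball_subset_ball ((min_le_right _ _).trans (min_le_left _ _))
  have hflip : ∀ y ∈ ball x ρ, ‖f y - f x‖ ≤ ε / 3 := by
    intro y hy
    refine le_of_tendsto ((hf y (hρr hy)).sub (hf x hx)).norm ?_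
    filter_upwards [hlip] with k hk using (hk y (hρδ hy)).trans (hsmall y hy)
  refine ⟨ball x ρ, mem_nhdsWithin_of_mem_nhds (ball_mem_nhds x hρ0), ?_⟩
  filter_upwards [hlip, Metric.tendsto_nhds.1 (hf x hx) (ε / 3) (by positivity)] with k hk hkx y hy
  have h1 := (hk y (hρδ hy)).trans (hsmall y hy)
  have h2 := hflip y hy
  rw [dist_eq_norm] at hkx ⊢
  have : f y - u k y = (f y - f x) - (u k x - f x) - (u k y - u k x) := by abel
  rw [this]
  have h3 := norm_sub_le ((f y - f x) - (u k x - f x)) (u k y - u k x)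
  have h4 := norm_sub_le (f y - f x) (u k x - f x)
  linarith

/-- The complex line through two points of a ball meets it in a disc. -/
theorem mapsTo_line_ball {c y : E} {R : ℝ} (hne : y ≠ c) :
    MapsTo (fun ζ : ℂ => c + ζ • (y - c)) (ball 0 (R / ‖y - c‖)) (ball c R) := by
  intro ζ hζ
  have h0 : 0 < ‖y - c‖ := norm_pos_iff.2 (sub_ne_zero.2 hne)
  rw [mem_ball, dist_eq_norm, add_sub_cancel_left, norm_smul]
  rw [mem_ball, dist_zero_right] at hζ
  exact (lt_div_iff₀ h0).1 hζ

theorem differentiableOn_comp_line {f : E → F} {c y : E} {R : ℝ}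
    (hf : DifferentiableOn ℂ f (ball c R)) (hne : y ≠ c) :
    DifferentiableOn ℂ (fun ζ : ℂ => f (c + ζ • (y - c))) (ball 0 (R / ‖y - c‖)) :=
  hf.comp (by fun_prop) (mapsTo_line_ball hne)

/-- The identity theorem on a ball. -/
theorem eqOn_zero_ball_of_eventuallyEq [CompleteSpace F] {f : E → F} {c : E} {R : ℝ}
    (hf : DifferentiableOn ℂ f (ball c R)) (h0 : ∀ᶠ y in 𝓝 c, f y = 0) :
    ∀ y ∈ ball c R, f y = 0 := by
  intro y hy
  rcases eq_or_ne y c with rfl | hne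
  · exact h0.self_of_nhds
  have h1 := one_mem_ball_div hy hne
  have han := (differentiableOn_comp_line hf hne).analyticOnNhd isOpen_ball
  have hev : (fun ζ : ℂ => f (c + ζ • (y - c))) =ᶠ[𝓝 0] 0 := by
    have hcont : Tendsto (fun ζ : ℂ => c + ζ • (y - c)) (𝓝 0) (𝓝 c) := by
      have : Continuous (fun ζ : ℂ => c + ζ • (y - c)) := by fun_prop
      simpa using this.tendsto 0
    exact hcont.eventually h0
  have := han.eqOn_zero_of_preconnected_of_eventuallyEq_zero
    (convex_ball _ _).isPreconnected (mem_ball_self (pos_of_mem_ball h1)) hev h1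
  simpa using this

/-- Hurwitz's theorem: a locally uniform limit of zero-free holomorphic functions on a connected
set is zero-free unless it vanishes identically. -/
theorem ne_zero_of_tendstoLocallyUniformlyOn [ProperSpace E] {ι : Type*} {l : Filter ι} [l.NeBot]
    {u : ι → E → ℂ} {f : E → ℂ} {U : Set E} (hU : IsOpen U) (hUc : IsPreconnected U)
    (hu : EventuallyHolomorphicOn l u U) (h : TendstoLocallyUniformlyOn u f l U)
    (hne : ∀ x ∈ U, ∃ δ > 0, ∀ᶠ k in l, ∀ y ∈ ball x δ, u k y ≠ 0)
    (hf : ∃ x ∈ U, f x ≠ 0) : ∀ x ∈ U, f x ≠ 0 := by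
  have hdf := differentiableOn_of_tendstoLocallyUniformlyOn hU hu h
  -- Every zero of `f` is interior to the zero set. Otherwise `f` is not identically zero on some
  -- complex line through `w`, and the one-variable argument applies there: `f` is bounded below by
  -- some `m > 0` on a small circle about `w`.
  have hloc : ∀ w ∈ U, f w = 0 → ∃ R > 0, ∀ y ∈ ball w R, f y = 0 := by
    intro w hw hw0
    obtain ⟨R₁, hR₁, hR₁U, hd₁, hT₁⟩ := exists_ball_tendstoUniformlyOn hU hu h hw
    obtain ⟨δ, hδ, hn₁⟩ := hne w hw
    set R := min R₁ δ with hR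
    have hR0 : 0 < R := lt_min hR₁ hδ
    have hRR : ball w R ⊆ ball w R₁ := ball_subset_ball (min_le_left _ _)
    have hRδ : ball w R ⊆ ball w δ := ball_subset_ball (min_le_right _ _)
    refine ⟨R, hR0, fun y hy => ?_⟩
    by_contra hy0
    have hyw : y ≠ w := by rintro rfl; exact hy0 hw0
    set p : ℂ → E := fun ζ => w + ζ • (y - w) with hp
    have hpb := mapsTo_line_ball (R := R) hyw
    have h1 := one_mem_ball_div hy hyw
    set ρ := R / ‖y - w‖ with hρ
    have hρ0 : 0 < ρ := pos_of_mem_ball h1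
    have han := (differentiableOn_comp_line (hdf.mono (hRR.trans hR₁U)) hyw).analyticOnNhd
      isOpen_ball
    have h0ρ : (0 : ℂ) ∈ ball (0 : ℂ) ρ := mem_ball_self hρ0
    have hpun : ∀ᶠ ζ in 𝓝[≠] (0 : ℂ), f (p ζ) ≠ 0 := by
      rcases (han 0 h0ρ).eventually_eq_zero_or_eventually_ne_zero with h2 | h2
      · have := han.eqOn_zero_of_preconnected_of_eventuallyEq_zero
          (convex_ball _ _).isPreconnected h0ρ h2 h1
        exact absurd (by simpa using this) hy0
      · exact h2
    obtain ⟨r₀, hr₀, hr₀'⟩ := Metric.mem_nhdsWithin_iff.1 hpun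
    set r := min r₀ ρ / 2 with hr
    have hr0 : 0 < r := by positivity
    have hrr₀ : r < r₀ := by
      have := min_le_left r₀ ρ
      have : 0 < min r₀ ρ := lt_min hr₀ hρ0
      rw [hr]; linarith
    have hrρ : r < ρ := by
      have := min_le_right r₀ ρ
      have : 0 < min r₀ ρ := lt_min hr₀ hρ0
      rw [hr]; linarith
    have hsub : closedBall (0 : ℂ) r ⊆ ball 0 ρ := closedBall_subset_ball hrρ
    have hsph : ∀ ζ ∈ sphere (0 : ℂ) r, 0 < ‖f (p ζ)‖ := by
      intro ζ hζ
      refine norm_pos_iff.2 (hr₀' ⟨?_, ?_⟩)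
      · exact mem_ball.2 ((mem_sphere.1 hζ).trans_lt hrr₀)
      · exact ne_of_mem_sphere hζ hr0.ne'
    have hcont : ContinuousOn (fun ζ => ‖f (p ζ)‖) (sphere (0 : ℂ) r) :=
      (han.continuousOn.mono (sphere_subset_closedBall.trans hsub)).norm
    obtain ⟨m, hm0, hm⟩ := (isCompact_sphere (0 : ℂ) r).exists_forall_le' hcont hsph
    have hev := Metric.tendstoUniformlyOn_iff.1 hT₁ (m / 2) (by positivity)
    obtain ⟨k, hk, hkd, hkn⟩ := (hev.and (hd₁.and hn₁)).exists
    have hpw : p 0 = w := by simp [hp]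
    have hψd : DifferentiableOn ℂ (fun ζ => (u k (p ζ))⁻¹) (ball 0 ρ) :=
      (differentiableOn_comp_line (hkd.mono hRR) hyw).fun_inv
        fun ζ hζ => hkn _ (hRδ (hpb hζ))
    -- The maximum principle for `1 / u k` carries the bound `m / 2 ≤ ‖u k‖` from the circle to `w`,
    -- where `‖u k‖ < m / 2` because `f w = 0`.
    have hmax : ‖(u k (p 0))⁻¹‖ ≤ (m / 2)⁻¹ := by
      refine Complex.norm_le_of_forall_mem_frontier_norm_le (f := fun ζ => (u k (p ζ))⁻¹)
        (U := ball (0 : ℂ) r) isBounded_ball ?_ ?_ (subset_closure (mem_ball_self hr0))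
      · exact (hψd.mono (closure_ball_subset_closedBall.trans hsub)).diffContOnCl
      · intro ζ hζ
        rw [frontier_ball _ hr0.ne'] at hζ
        have h3 := hm ζ hζ
        have h4 := hk (p ζ) (hRR (hpb (hsub (sphere_subset_closedBall hζ))))
        rw [dist_eq_norm] at h4
        have h5 : m / 2 ≤ ‖u k (p ζ)‖ := by
          have := norm_sub_norm_le (f (p ζ)) (u k (p ζ))
          linarith
        rw [norm_inv]
        gcongr
    rw [hpw, norm_inv] at hmax
    have hpos : 0 < ‖u k w‖ := norm_pos_iff.2 (hkn w (mem_ball_self hδ))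
    have h6 : m / 2 ≤ ‖u k w‖ := (inv_le_inv₀ hpos (by positivity)).1 hmax
    have h7 := hk w (mem_ball_self hR₁)
    rw [hw0, dist_zero_left] at h7
    linarith
  have hopen : IsOpen (U ∩ f ⁻¹' {0}ᶜ) :=
    hdf.continuousOn.isOpen_inter_preimage hU isOpen_compl_singleton
  obtain ⟨x₀, hx₀, hx₀'⟩ := hf
  have := hUc.subset_of_closure_inter_subset hopen ⟨x₀, hx₀, hx₀, hx₀'⟩ (by
    rintro w ⟨hwc, hwU⟩
    refine ⟨hwU, fun hw0 => ?_⟩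
    obtain ⟨R, hR, hRz⟩ := hloc w hwU hw0
    obtain ⟨y, hy, hyw⟩ := Metric.mem_closure_iff.1 hwc R hR
    exact hy.2 (hRz y (by rwa [mem_ball, dist_comm])))
  exact fun x hx => (this hx).2

/-- A holomorphic map into the closed unit ball that vanishes somewhere takes values in the open
unit ball. -/
theorem norm_lt_one_of_norm_le_one {f : E → F} {U : Set E} (hU : IsOpen U) (hUc : IsPreconnected U)
    (hf : DifferentiableOn ℂ f U) (h1 : ∀ x ∈ U, ‖f x‖ ≤ 1) {x₀ : E} (hx₀ : x₀ ∈ U)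
    (h0 : f x₀ = 0) : ∀ x ∈ U, ‖f x‖ < 1 := by
  intro x hx
  refine lt_of_le_of_ne (h1 x hx) fun h => ?_
  have hmax : IsMaxOn (norm ∘ f) U x := fun y hy => by
    simpa [h] using h1 y hy
  have := Complex.norm_eqOn_of_isPreconnected_of_isMaxOn hUc hU hf hx hmax hx₀
  simp [h0, h] at this

end NormalFamilies

/-! ### Inverse function theorem, stable under locally uniform limits. -/

section LocalInverse

open Metric

/-- A map with a differentiable local left inverse has invertible derivative. -/
theorem det_mul_det_eq_one {E : Type*} [NormedAddCommGroup E] [NormedSpace ℂ E]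
    {f g : E → E} {a : E} (hf : DifferentiableAt ℂ f a)
    (hg : DifferentiableAt ℂ g (f a)) (hgf : ∀ᶠ x in 𝓝 a, g (f x) = x) :
    (fderiv ℂ g (f a)).det * (fderiv ℂ f a).det = 1 := by
  have h1 : fderiv ℂ (fun x => g (f x)) a = ContinuousLinearMap.id ℂ E := by
    rw [(show (fun x => g (f x)) =ᶠ[𝓝 a] id from hgf).fderiv_eq, fderiv_id]
  have h2 : fderiv ℂ (fun x => g (f x)) a = (fderiv ℂ g (f a)).comp (fderiv ℂ f a) :=
    fderiv_comp a hg hf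
  have h3 : ((fderiv ℂ g (f a)).comp (fderiv ℂ f a)).det = 1 := by
    rw [← h2, h1]; simp [ContinuousLinearMap.det]
  rw [← h3]
  simp [ContinuousLinearMap.det, LinearMap.det_comp]

variable {E : Type} [NormedAddCommGroup E] [NormedSpace ℂ E] [FiniteDimensional ℂ E]

/-- If `u k` converges to `f` locally uniformly and `f` is locally invertible at `a`, then `f a` is
eventually attained by `u k` near `a`. -/
theorem eventually_mem_image_ball {ι : Type*} {l : Filter ι} [l.NeBot]
    {u : ι → E → E} {f : E → E} {U : Set E} (hU : IsOpen U)
    (hu : EventuallyHolomorphicOn l u U) (h : TendstoLocallyUniformlyOn u f l U)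
    {a : E} (ha : a ∈ U) (hdet : (fderiv ℂ f a).det ≠ 0) {ε : ℝ} (hε : 0 < ε) :
    ∀ᶠ k in l, f a ∈ u k '' ball a ε := by
  have hprop : ProperSpace E := FiniteDimensional.proper ℂ E
  have hcomp : CompleteSpace E := FiniteDimensional.complete ℂ E
  set A := (fderiv ℂ f a).toContinuousLinearEquivOfDetNeZero hdet with hA
  have hAf : (A : E →L[ℂ] E) = fderiv ℂ f a :=
    ContinuousLinearMap.coe_toContinuousLinearEquivOfDetNeZero _ _
  -- The `+ 1` keeps the constant positive also when `E` is trivial and the operator norm is zero.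
  let inv : (A : E →L[ℂ] E).NonlinearRightInverse :=
    { toFun := A.symm
      nnnorm := ‖(A.symm : E →L[ℂ] E)‖₊ + 1
      bound' := fun y => ((A.symm : E →L[ℂ] E).le_opNorm y).trans (by
        push_cast; gcongr; simp)
      right_inv' := fun y => by simp }
  have hinv0 : 0 < inv.nnnorm := by simp [inv]
  -- Half of the admissible linear approximation error. It is spent in two halves: one on the
  -- variation of `fderiv ℂ f` near `a`, one on its distance from `fderiv ℂ (u k)`.
  set c : NNReal := inv.nnnorm⁻¹ / 2 with hc
  have hc0 : 0 < c := by positivity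
  have hdf := differentiableOn_of_tendstoLocallyUniformlyOn hU hu h
  have hcontf : ContinuousAt (fderiv ℂ f) a :=
    (differentiableOn_fderiv hU hdf).continuousOn.continuousAt (hU.mem_nhds ha)
  have hEH : EventuallyHolomorphicOn l u U := hu
  obtain ⟨R, hR, hRU, hd, hT⟩ := exists_ball_tendstoUniformlyOn hU hu h ha
  have hT' := (tendstoUniformlyOn_fderiv_ball hR hd hT).2
  obtain ⟨r₁, hr₁, hr₁'⟩ := Metric.continuousAt_iff.1 hcontf (c / 2) (by positivity)
  set r := min r₁ (R / 2) with hr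
  have hr0 : 0 < r := by positivity
  have hrR : ball a r ⊆ ball a (R / 2) := ball_subset_ball (min_le_right _ _)
  have hrR' : ball a r ⊆ ball a R := hrR.trans (ball_subset_ball (by linarith))
  set ε' := min (r / 2) (ε / 2) with hε'
  have hε'0 : 0 < ε' := by positivity
  have hε'r : ε' < r := (min_le_left _ _).trans_lt (by linarith)
  have hε'ε : ε' < ε := (min_le_right _ _).trans_lt (by linarith)
  have hcinv : (c : ℝ) < (inv.nnnorm : ℝ)⁻¹ := by
    rw [hc]; push_cast
    have : 0 < (inv.nnnorm : ℝ)⁻¹ := by positivity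
    linarith
  have hpos : 0 < ((inv.nnnorm : ℝ)⁻¹ - c) * ε' := mul_pos (by linarith) hε'0
  filter_upwards [hd, Metric.tendstoUniformlyOn_iff.1 hT' (c / 2) (by positivity),
    Metric.tendsto_nhds.1 (hT.tendsto_at (mem_ball_self hR)) _ hpos] with k hkd hk hka
  have happ : ApproximatesLinearOn (u k) (A : E →L[ℂ] E) (ball a r) c := by
    intro x hx y hy
    refine (convex_ball a r).norm_image_sub_le_of_norm_fderiv_le' (𝕜 := ℂ) (fun z hz => ?_)
      (fun z hz => ?_) hy hx
    · exact (hkd z (hrR' hz)).differentiableAt (isOpen_ball.mem_nhds (hrR' hz))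
    · rw [hAf]
      have h1 := hk z (hrR hz)
      have h2 := hr₁' ((mem_ball.1 hz).trans_le (min_le_left _ _))
      rw [← dist_eq_norm]
      have h3 := dist_triangle (fderiv ℂ (u k) z) (fderiv ℂ f z) (fderiv ℂ f a)
      rw [dist_comm (fderiv ℂ (u k) z) (fderiv ℂ f z)] at h3
      linarith
  -- The image of the `ε'`-ball under `u k` contains a ball about `u k a` whose radius does not
  -- depend on `k`, and `f a` eventually lies in it.
  have hs := happ.surjOn_closedBall_of_nonlinearRightInverse inv hε'0.le
    (closedBall_subset_ball hε'r)
  obtain ⟨p, hp, hpk⟩ := hs (show f a ∈ _ by rw [mem_closedBall, dist_comm]; exact hka.le)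
  exact ⟨p, closedBall_subset_ball hε'ε hp, hpk⟩

/-- A locally invertible locally uniform limit of injective holomorphic maps is injective. -/
theorem injOn_of_tendstoLocallyUniformlyOn {ι : Type*} {l : Filter ι} [l.NeBot]
    {u : ι → E → E} {f : E → E} {U : Set E} (hU : IsOpen U)
    (hu : EventuallyHolomorphicOn l u U) (h : TendstoLocallyUniformlyOn u f l U)
    (hdet : ∀ x ∈ U, (fderiv ℂ f x).det ≠ 0)
    (hinj : ∀ x ∈ U, ∀ y ∈ U, ∃ δ > 0, ∀ᶠ k in l, InjOn (u k) (ball x δ ∪ ball y δ)) :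
    InjOn f U := by
  intro x hx y hy hxy
  by_contra hne
  obtain ⟨δ, hδ, hk⟩ := hinj x hx y hy
  have hd : 0 < dist x y := dist_pos.2 hne
  -- The balls of radius `ε` about `x` and `y` are disjoint, yet `u k` attains the common value `f x
  -- = f y` in both.
  set ε := min δ (dist x y / 2) with hε
  have hε0 : 0 < ε := by positivity
  obtain ⟨k, hk, ⟨p, hp, hpk⟩, ⟨q, hq, hqk⟩⟩ := (hk.and
    ((eventually_mem_image_ball hU hu h hx (hdet x hx) hε0).and
      (eventually_mem_image_ball hU hu h hy (hdet y hy) hε0))).exists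
  have hsub : ∀ z : E, ball z ε ⊆ ball z δ := fun z => ball_subset_ball (min_le_left _ _)
  have hpq : p = q := hk (Or.inl (hsub _ hp)) (Or.inr (hsub _ hq)) (by rw [hpk, hqk, hxy])
  subst hpq
  have h1 : ε ≤ dist x y / 2 := min_le_right _ _
  have h2 := dist_triangle_left x y p
  have h3 := mem_ball.1 hp
  have h4 := mem_ball.1 hq
  linarith

theorem hasStrictFDerivAt_of_det_ne_zero {f : E → E} {U : Set E} (hU : IsOpen U)
    (hf : DifferentiableOn ℂ f U) {x : E} (hx : x ∈ U) (hdet : (fderiv ℂ f x).det ≠ 0) :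
    ∃ A : E ≃L[ℂ] E, HasStrictFDerivAt f (A : E →L[ℂ] E) x := by
  have hcomp : CompleteSpace E := FiniteDimensional.complete ℂ E
  refine ⟨(fderiv ℂ f x).toContinuousLinearEquivOfDetNeZero hdet, ?_⟩
  rw [ContinuousLinearMap.coe_toContinuousLinearEquivOfDetNeZero]
  exact ((contDiffOn_of_differentiableOn hU hf 1).contDiffAt (hU.mem_nhds hx)).hasStrictFDerivAt
    (by simp)

theorem image_mem_nhds_of_det_ne_zero {f : E → E} {U : Set E} (hU : IsOpen U)
    (hf : DifferentiableOn ℂ f U) {x : E} (hx : x ∈ U) (hdet : (fderiv ℂ f x).det ≠ 0) :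
    f '' U ∈ 𝓝 (f x) := by
  have hcomp : CompleteSpace E := FiniteDimensional.complete ℂ E
  obtain ⟨A, hA⟩ := hasStrictFDerivAt_of_det_ne_zero hU hf hx hdet
  rw [← hA.map_nhds_eq_of_equiv]
  exact image_mem_map (hU.mem_nhds hx)

/-- The inverse of an injective locally biholomorphic map is holomorphic. -/
theorem differentiableOn_invFunOn {f : E → E} {U : Set E} (hU : IsOpen U)
    (hf : DifferentiableOn ℂ f U) (hdet : ∀ x ∈ U, (fderiv ℂ f x).det ≠ 0) (hinj : InjOn f U) :
    IsOpen (f '' U) ∧ DifferentiableOn ℂ (Function.invFunOn f U) (f '' U) := by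
  have hcomp : CompleteSpace E := FiniteDimensional.complete ℂ E
  constructor
  · rw [isOpen_iff_mem_nhds]
    rintro _ ⟨x, hx, rfl⟩
    exact image_mem_nhds_of_det_ne_zero hU hf hx (hdet x hx)
  · rintro _ ⟨x, hx, rfl⟩
    obtain ⟨A, hA⟩ := hasStrictFDerivAt_of_det_ne_zero hU hf hx (hdet x hx)
    have := hA.to_local_left_inverse (g := Function.invFunOn f U) (by
      filter_upwards [hU.mem_nhds hx] with y hy using hinj.leftInvOn_invFunOn hy)
    exact this.hasFDerivAt.differentiableAt.differentiableWithinAt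

end LocalInverse

/-! ### Mean value inequality and change of variables. -/

section MeanValue

open Metric

variable {n : ℕ}

/-- The circular average of the square of a holomorphic function. -/
theorem enorm_sq_mul_two_pi_le {φ : Cn n → ℂ} {v y : Cn n} {r : ℝ}
    (hφ : DifferentiableOn ℂ φ (ball v r)) (hy : y ∈ ball (0 : Cn n) r) :
    ‖φ v‖ₑ ^ 2 * ENNReal.ofReal (2 * Real.pi) ≤
      ∫⁻ θ in Ioc 0 (2 * Real.pi), ‖φ (v + circleMap 0 1 θ • y)‖ₑ ^ 2 := by
  rw [mem_ball, dist_zero_right] at hy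
  have hmaps : MapsTo (fun ζ : ℂ => v + ζ • y) (closedBall 0 1) (ball v r) := by
    intro ζ hζ
    rw [mem_ball, dist_eq_norm, add_sub_cancel_left, norm_smul]
    rw [mem_closedBall, dist_zero_right] at hζ
    nlinarith [norm_nonneg y]
  -- The function averaged is `φ ^ 2`, not its modulus: it is holomorphic, so the mean value
  -- property is an equality and only the triangle inequality remains.
  have hd : DiffContOnCl ℂ (fun ζ : ℂ => φ (v + ζ • y) ^ 2) (ball 0 |1|) := by
    rw [abs_one]
    refine DifferentiableOn.diffContOnCl ?_
    rw [closure_ball _ one_ne_zero]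
    exact (hφ.comp (by fun_prop) hmaps).fun_pow 2
  have hav := hd.circleAverage
  simp only [Real.circleAverage, zero_smul, add_zero] at hav
  have hpi : 0 < 2 * Real.pi := Real.two_pi_pos
  have hint : (∫ θ in (0 : ℝ)..2 * Real.pi, φ (v + circleMap 0 1 θ • y) ^ 2) =
      (2 * Real.pi : ℝ) • φ v ^ 2 := by
    rw [← hav, smul_inv_smul₀ hpi.ne']
  rw [intervalIntegral.integral_of_le hpi.le] at hint
  have h1 := enorm_integral_le_lintegral_enorm (μ := volume.restrict (Ioc 0 (2 * Real.pi)))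
    fun θ => φ (v + circleMap 0 1 θ • y) ^ 2
  rw [hint, enorm_smul] at h1
  simp only [enorm_pow] at h1
  rw [Real.enorm_of_nonneg hpi.le, mul_comm] at h1
  exact h1

/-- Multiplication by a unimodular number preserves Lebesgue measure. -/
theorem measurePreserving_smul_of_norm_eq_one {ζ : ℂ} (hζ : ‖ζ‖ = 1) :
    MeasurePreserving (fun y : Cn n => ζ • y) volume volume := by
  have h0 : ζ ≠ 0 := by rintro rfl; simp at hζ
  let e : Cn n ≃ₗᵢ[ℝ] Cn n :=
    { (LinearEquiv.smulOfNeZero ℂ (Cn n) ζ h0).restrictScalars ℝ with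
      norm_map' := fun y => by
        show ‖ζ • y‖ = ‖y‖
        rw [norm_smul, hζ, one_mul] }
  exact e.measurePreserving

/-- The mean value inequality for the square of a holomorphic function on a ball. -/
theorem enorm_sq_mul_volume_ball_le {φ : Cn n → ℂ} {v : Cn n} {r : ℝ}
    (hφ : DifferentiableOn ℂ φ (ball v r)) :
    ‖φ v‖ₑ ^ 2 * volume (ball v r) ≤ ∫⁻ y in ball v r, ‖φ y‖ₑ ^ 2 := by
  classical
  -- Extension by zero gives a globally measurable function, to which Tonelli's theorem and rotation
  -- invariance apply on the whole space.
  set G : Cn n → ℝ≥0∞ := (ball (0 : Cn n) r).piecewise (fun y => ‖φ (v + y)‖ₑ ^ 2) 0 with hG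
  have hmaps : MapsTo (fun y => v + y) (ball (0 : Cn n) r) (ball v r) := fun y hy => by
    simpa [dist_eq_norm] using hy
  have hGm : Measurable G := by
    refine ContinuousOn.measurable_piecewise ?_ continuousOn_const measurableSet_ball
    have h1 : ContinuousOn (fun y => φ (v + y)) (ball (0 : Cn n) r) :=
      hφ.continuousOn.comp (by fun_prop) hmaps
    exact (ENNReal.continuous_pow 2).comp_continuousOn h1.enorm
  have hGint : ∫⁻ y, G y = ∫⁻ y in ball v r, ‖φ y‖ₑ ^ 2 := by
    have h1 : ∀ y, G y = (ball v r).indicator (fun y => ‖φ y‖ₑ ^ 2) (v + y) := by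
      intro y
      by_cases hy : y ∈ ball (0 : Cn n) r
      · rw [hG, piecewise_eq_of_mem _ _ _ hy, indicator_of_mem (hmaps hy)]
      · rw [hG, piecewise_eq_of_notMem _ _ _ hy, indicator_of_notMem]
        · rfl
        · simpa [dist_eq_norm] using hy
    rw [← lintegral_indicator measurableSet_ball,
      ← lintegral_add_left_eq_self ((ball v r).indicator fun y => ‖φ y‖ₑ ^ 2) v]
    exact lintegral_congr h1
  have hpi : 0 < 2 * Real.pi := Real.two_pi_pos
  have hGrot : ∀ θ : ℝ, ∫⁻ y, G (circleMap 0 1 θ • y) = ∫⁻ y, G y := fun θ =>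
    (measurePreserving_smul_of_norm_eq_one (by simp [circleMap])).lintegral_comp hGm
  -- Averaging over the circles `θ ↦ exp(iθ) y` does not change the integral over the ball, since
  -- each rotation preserves volume. This replaces polar coordinates.
  have hswap : ∫⁻ y, ∫⁻ θ in Ioc 0 (2 * Real.pi), G (circleMap 0 1 θ • y) =
      (∫⁻ y, G y) * ENNReal.ofReal (2 * Real.pi) := by
    rw [lintegral_lintegral_swap]
    · simp_rw [hGrot]
      simp
    · refine (hGm.comp ?_).aemeasurable
      have : Continuous fun p : Cn n × ℝ => circleMap 0 1 p.2 • p.1 := by fun_prop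
      exact this.measurable
  have hle : ∀ y, (ball (0 : Cn n) r).indicator
      (fun _ => ‖φ v‖ₑ ^ 2 * ENNReal.ofReal (2 * Real.pi)) y ≤
      ∫⁻ θ in Ioc 0 (2 * Real.pi), G (circleMap 0 1 θ • y) := by
    intro y
    by_cases hy : y ∈ ball (0 : Cn n) r
    · rw [indicator_of_mem hy]
      refine (enorm_sq_mul_two_pi_le hφ hy).trans_eq (lintegral_congr fun θ => ?_)
      rw [hG, piecewise_eq_of_mem]
      rw [mem_ball, dist_zero_right] at hy ⊢
      simpa [norm_smul, circleMap] using hy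
    · rw [indicator_of_notMem hy]
      exact zero_le
  have hfin := lintegral_mono (μ := volume) hle
  rw [hswap, hGint, lintegral_indicator measurableSet_ball, lintegral_const,
    Measure.restrict_apply_univ] at hfin
  have hvol : volume (ball (0 : Cn n) r) = volume (ball v r) :=
    (Measure.addHaar_ball_center volume v r).symm
  rw [hvol, mul_right_comm] at hfin
  exact (ENNReal.mul_le_mul_iff_left (by simpa using hpi) ENNReal.ofReal_ne_top).1 hfin

/-- The complex Jacobian determinant controls the real one. -/
theorem abs_det_restrictScalars (A : Cn n →L[ℂ] Cn n) :
    |(A.restrictScalars ℝ).det| = ‖A.det‖ ^ 2 := by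
  have h : (A.restrictScalars ℝ).det = Algebra.norm ℝ A.det :=
    LinearMap.det_restrictScalars (R := ℝ) (S := ℂ) (f := (A : Cn n →ₗ[ℂ] Cn n))
  rw [h, Algebra.norm_complex_apply, Complex.normSq_eq_norm_sq, abs_of_nonneg (by positivity)]

/-- Change of variables for an injective holomorphic map. -/
theorem lintegral_image_holomorphic {f : Cn n → Cn n} {U : Set (Cn n)} (hU : IsOpen U)
    (hf : DifferentiableOn ℂ f U) (hinj : InjOn f U) (g : Cn n → ℝ≥0∞) :
    ∫⁻ x in f '' U, g x = ∫⁻ x in U, ‖(fderiv ℂ f x).det‖ₑ ^ 2 * g (f x) := by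
  rw [lintegral_image_eq_lintegral_abs_det_fderiv_mul volume hU.measurableSet
    (f' := fun x => (fderiv ℂ f x).restrictScalars ℝ) (fun x hx =>
      ((hf x hx).differentiableAt (hU.mem_nhds hx)).hasFDerivAt.restrictScalars ℝ
        |>.hasFDerivWithinAt) hinj]
  refine lintegral_congr fun x => ?_
  rw [abs_det_restrictScalars, ENNReal.ofReal_pow (norm_nonneg _), ofReal_norm]

end MeanValue

/-! ### The Bergman kernel and metric: smoothness and continuity. -/

section Kernel

open Metric

variable {n : ℕ}

theorem enorm_sq_eq_ofReal (z : ℂ) : ‖z‖ₑ ^ 2 = ENNReal.ofReal (‖z‖ ^ 2) := by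
  rw [ENNReal.ofReal_pow (norm_nonneg _), ofReal_norm]

/-- A locally square summable family of holomorphic functions is a holomorphic map into `ℓ²`. -/
theorem exists_differentiableOn_lp {S : Type} {φ : S → Cn n → ℂ} {x : Cn n} {r C : ℝ} (hr : 0 < r)
    (hφ : ∀ i, DifferentiableOn ℂ (φ i) (ball x (2 * r)))
    (hC : ∀ v ∈ ball x (2 * r), ∀ s : Finset S, ∑ i ∈ s, ‖φ i v‖ ^ 2 ≤ C) :
    ∃ Φ : Cn n → lp (fun _ : S => ℂ) 2, DifferentiableOn ℂ Φ (ball x (r / 2)) ∧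
      ∀ v ∈ ball x (r / 2), ‖Φ v‖ ^ 2 = ∑' i, ‖φ i v‖ ^ 2 := by
  classical
  have hC0 : 0 ≤ C := by simpa using hC x (mem_ball_self (by positivity)) ∅
  set b := volume (ball x r) with hb
  have hb0 : b ≠ 0 := (measure_ball_pos volume x hr).ne'
  have hbt : b ≠ ⊤ := measure_ball_lt_top.ne
  set I : S → ℝ≥0∞ := fun i => ∫⁻ y in ball x (2 * r), ‖φ i y‖ₑ ^ 2 with hI
  set T := ENNReal.ofReal C * volume (ball x (2 * r)) with hT
  have hTt : T ≠ ⊤ := ENNReal.mul_ne_top ENNReal.ofReal_ne_top measure_ball_lt_top.ne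
  have hIsum : ∀ s : Finset S, ∑ i ∈ s, I i ≤ T := by
    intro s
    rw [hI, ← lintegral_finsetSum' s (fun i _ => ?_), hT, ← setLIntegral_const]
    · refine setLIntegral_mono' measurableSet_ball fun y hy => ?_
      simp_rw [enorm_sq_eq_ofReal]
      rw [← ENNReal.ofReal_sum_of_nonneg (fun i _ => by positivity)]
      exact ENNReal.ofReal_le_ofReal (hC y hy s)
    · exact ((ENNReal.continuous_pow 2).comp_continuousOn
        (hφ i).continuousOn.enorm).aemeasurable measurableSet_ball
  have hIt : ∀ i, I i ≠ ⊤ := fun i => ne_top_of_le_ne_top hTt (by simpa using hIsum {i})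
  -- The mean value inequality makes `M` a majorant of `‖φ i v‖ ^ 2` that is independent of `v` and
  -- summable. The finite partial sums therefore converge uniformly in `ℓ²`, as in the Weierstrass
  -- M-test.
  set M : S → ℝ := fun i => (I i / b).toReal with hM
  have hM0 : ∀ i, 0 ≤ M i := fun i => ENNReal.toReal_nonneg
  have hMs : Summable M := by
    refine summable_of_sum_le (c := (T / b).toReal) hM0 fun s => ?_
    rw [hM, ← ENNReal.toReal_sum fun i _ => ENNReal.div_ne_top (hIt i) hb0]
    refine ENNReal.toReal_mono (ENNReal.div_ne_top hTt hb0) ?_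
    simp_rw [div_eq_mul_inv]
    rw [← Finset.sum_mul]
    gcongr
    exact hIsum s
  have hle : ∀ v ∈ ball x r, ∀ i, ‖φ i v‖ ^ 2 ≤ M i := by
    intro v hv i
    have hsub : ball v r ⊆ ball x (2 * r) := ball_subset_ball' (by linarith [mem_ball.1 hv])
    have h1 := enorm_sq_mul_volume_ball_le ((hφ i).mono hsub)
    have hvol : volume (ball v r) = b := by
      rw [hb, Measure.addHaar_ball_center, Measure.addHaar_ball_center volume x]
    rw [hvol] at h1
    have h2 : ‖φ i v‖ₑ ^ 2 ≤ I i / b := by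
      rw [ENNReal.le_div_iff_mul_le (Or.inl hb0) (Or.inl hbt)]
      exact h1.trans (lintegral_mono_set hsub)
    rw [enorm_sq_eq_ofReal] at h2
    exact (ENNReal.ofReal_le_iff_le_toReal (ENNReal.div_ne_top (hIt i) hb0)).1 h2
  have hsum : ∀ v ∈ ball x r, Summable fun i => ‖φ i v‖ ^ 2 := fun v hv =>
    hMs.of_nonneg_of_le (fun i => by positivity) (hle v hv)
  have h2 : (0 : ℝ) < (2 : ℝ≥0∞).toReal := by norm_num
  have hmem : ∀ v ∈ ball x r, Memℓp (fun i => φ i v) 2 := fun v hv => by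
    refine memℓp_gen ?_
    simpa using hsum v hv
  set Φ : Cn n → lp (fun _ : S => ℂ) 2 := fun v =>
    if hv : v ∈ ball x r then ⟨fun i => φ i v, hmem v hv⟩ else 0 with hΦ
  have hΦc : ∀ v ∈ ball x r, ∀ i, Φ v i = φ i v := by
    intro v hv i
    simp only [hΦ, dif_pos hv]
  set u : Finset S → Cn n → lp (fun _ : S => ℂ) 2 := fun s v =>
    ∑ i ∈ s, lp.singleContinuousLinearMap ℂ (fun _ : S => ℂ) 2 i (φ i v) with hu
  have hud : ∀ s, DifferentiableOn ℂ (u s) (ball x r) := fun s =>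
    DifferentiableOn.fun_sum fun i _ => (ContinuousLinearMap.differentiable _).comp_differentiableOn
      ((hφ i).mono (ball_subset_ball (by linarith)))
  have hunif : TendstoUniformlyOn u Φ atTop (ball x r) := by
    rw [Metric.tendstoUniformlyOn_iff]
    intro ε hε
    have htail := tendsto_tsum_compl_atTop_zero M
    filter_upwards [htail.eventually (gt_mem_nhds (show 0 < ε ^ 2 by positivity))] with s hs v hv
    have h3 := lp.norm_compl_sum_single h2 (Φ v) s
    have h4 := lp.norm_rpow_eq_tsum h2 (Φ v)
    simp only [ENNReal.toReal_ofNat, Real.rpow_ofNat, hΦc v hv] at h3 h4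
    have h5 : ‖Φ v - u s v‖ ^ 2 = ∑' i : {i // i ∉ s}, ‖φ i v‖ ^ 2 := by
      have h6 := (hsum v hv).sum_add_tsum_compl (s := s)
      have h7 : u s v = ∑ i ∈ s, lp.single 2 i (φ i v) := by
        simp [hu, lp.singleContinuousLinearMap_apply]
      rw [h7, h3, h4, ← h6]
      simp only [add_sub_cancel_left]
      rfl
    have h6 : ∑' i : {i // i ∉ s}, ‖φ i v‖ ^ 2 ≤ ∑' i : {i // i ∉ s}, M i :=
      ((hsum v hv).subtype _).tsum_le_tsum (fun i => hle v hv i) (hMs.subtype _)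
    rw [dist_eq_norm]
    refine lt_of_pow_lt_pow_left₀ 2 hε.le ?_
    rw [h5]
    exact h6.trans_lt hs
  refine ⟨Φ, (tendstoUniformlyOn_fderiv_ball hr (Eventually.of_forall hud) hunif).1, ?_⟩
  intro v hv
  have hv' : v ∈ ball x r := ball_subset_ball (by linarith) hv
  have h4 := lp.norm_rpow_eq_tsum h2 (Φ v)
  simpa only [ENNReal.toReal_ofNat, Real.rpow_ofNat, hΦc v hv'] using h4

theorem holRep_differentiableOn {X : Set (Cn n)} (f : bergmanSpace X) :
    DifferentiableOn ℂ (holRep f) X := f.2.choose_spec.1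

theorem holRep_ae_eq {X : Set (Cn n)} (f : bergmanSpace X) :
    ((f : Lp ℂ 2 ((volume : Measure (Cn n)).restrict X)) : Cn n → ℂ) =ᵐ[volume.restrict X]
      holRep f := f.2.choose_spec.2

theorem orthonormal_bergmanBasis (X : Set (Cn n)) :
    Orthonormal ℂ (Subtype.val : bergmanBasis X → bergmanSpace X) :=
  (exists_maximal_orthonormal (orthonormal_empty ℂ (bergmanSpace X))).choose_spec.2.1

theorem lintegral_enorm_sq_Lp {μ : Measure (Cn n)} (f : Lp ℂ 2 μ) :
    ∫⁻ y, ‖f y‖ₑ ^ 2 ∂μ = ENNReal.ofReal (‖f‖ ^ 2) := by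
  have h := eLpNorm_nnreal_pow_eq_lintegral (f := f) (μ := μ) (p := 2) (by norm_num)
  rw [ENNReal.ofReal_pow (norm_nonneg _), ofReal_norm, Lp.enorm_def]
  simpa using h.symm

theorem norm_sum_smul_sq_of_orthonormal {H ι : Type*} [NormedAddCommGroup H]
    [InnerProductSpace ℂ H] {v : ι → H} (hv : Orthonormal ℂ v) (a : ι → ℂ) (s : Finset ι) :
    ‖∑ i ∈ s, a i • v i‖ ^ 2 = ∑ i ∈ s, ‖a i‖ ^ 2 := by
  have h1 := hv.inner_sum a a s
  rw [inner_self_eq_norm_sq_to_K] at h1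
  have h2 : ∑ i ∈ s, (starRingEnd ℂ) (a i) * a i = ((∑ i ∈ s, ‖a i‖ ^ 2 : ℝ) : ℂ) := by
    push_cast
    refine Finset.sum_congr rfl fun i _ => ?_
    rw [mul_comm, Complex.mul_conj, Complex.normSq_eq_norm_sq]
    push_cast; rfl
  rw [h2] at h1
  simpa [← Complex.ofReal_pow] using congrArg Complex.re h1

/-- Evaluation at a point is bounded on the Bergman space. -/
theorem norm_sq_mul_volume_le {X : Set (Cn n)} {v : Cn n} {r : ℝ}
    (hv : ball v r ⊆ X) (f : Lp ℂ 2 ((volume : Measure (Cn n)).restrict X)) {Ψ : Cn n → ℂ}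
    (hΨ : DifferentiableOn ℂ Ψ X) (hf : f =ᵐ[volume.restrict X] Ψ) :
    ‖Ψ v‖ ^ 2 * (volume (ball v r)).toReal ≤ ‖f‖ ^ 2 := by
  have h1 := enorm_sq_mul_volume_ball_le (hΨ.mono hv)
  have h2 : ∫⁻ y in ball v r, ‖Ψ y‖ₑ ^ 2 ≤ ENNReal.ofReal (‖f‖ ^ 2) := by
    rw [← lintegral_enorm_sq_Lp]
    refine (lintegral_mono_set hv).trans (lintegral_congr_ae ?_).le
    filter_upwards [hf] with y hy
    rw [hy]
  have h3 := h1.trans h2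
  rw [enorm_sq_eq_ofReal, ← ENNReal.ofReal_toReal (measure_ball_lt_top (μ := volume)).ne,
    ← ENNReal.ofReal_mul (by positivity), ENNReal.ofReal_le_ofReal_iff (by positivity)] at h3
  exact h3

theorem coeFn_sum_smul_ae_eq {X : Set (Cn n)} (a : bergmanBasis X → ℂ)
    (s : Finset (bergmanBasis X)) :
    (∑ φ ∈ s, a φ • ((φ.1 : bergmanSpace X) : Lp ℂ 2 ((volume : Measure (Cn n)).restrict X)) :
      Lp ℂ 2 ((volume : Measure (Cn n)).restrict X)) =ᵐ[volume.restrict X]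
      fun y => ∑ φ ∈ s, a φ * holRep φ.1 y := by
  classical
  induction s using Finset.induction_on with
  | empty =>
    simp only [Finset.sum_empty]
    exact Lp.coeFn_zero _ _ _
  | insert φ s hφ ih =>
    simp only [Finset.sum_insert hφ]
    filter_upwards [Lp.coeFn_add (a φ • (φ.1 : Lp ℂ 2 ((volume : Measure (Cn n)).restrict X)))
      (∑ φ ∈ s, a φ • ((φ.1 : bergmanSpace X) : Lp ℂ 2 ((volume : Measure (Cn n)).restrict X))),
      Lp.coeFn_smul (a φ) (φ.1 : Lp ℂ 2 ((volume : Measure (Cn n)).restrict X)),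
      holRep_ae_eq φ.1, ih] with y h1 h2 h3 h4
    rw [h1, Pi.add_apply, h2, h4, Pi.smul_apply, h3, smul_eq_mul]

/-- Bessel's inequality for the orthonormal basis, evaluated at a point. -/
theorem sum_norm_sq_holRep_le {X : Set (Cn n)} {v : Cn n} {r : ℝ} (hr : 0 < r)
    (hv : ball v r ⊆ X) (s : Finset (bergmanBasis X)) :
    ∑ φ ∈ s, ‖holRep φ.1 v‖ ^ 2 ≤ (volume (ball v r)).toReal⁻¹ := by
  set T := ∑ φ ∈ s, ‖holRep φ.1 v‖ ^ 2 with hT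
  have hT0 : 0 ≤ T := Finset.sum_nonneg fun _ _ => by positivity
  -- With these coefficients the finite sum has value `T` at `v` and squared norm `T`. Bounded
  -- evaluation then reads `T ^ 2 * vol ≤ T`.
  set a : bergmanBasis X → ℂ := fun φ => (starRingEnd ℂ) (holRep φ.1 v) with ha
  have horth : Orthonormal ℂ fun φ : bergmanBasis X =>
      ((φ.1 : bergmanSpace X) : Lp ℂ 2 ((volume : Measure (Cn n)).restrict X)) :=
    (orthonormal_bergmanBasis X).comp_linearIsometry (bergmanSpace X).subtypeₗᵢ
  have hnorm := norm_sum_smul_sq_of_orthonormal horth a s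
  have hΨv : ∑ φ ∈ s, a φ * holRep φ.1 v = (T : ℂ) := by
    rw [hT]; push_cast
    refine Finset.sum_congr rfl fun φ _ => ?_
    rw [ha, mul_comm, Complex.mul_conj, Complex.normSq_eq_norm_sq]
    push_cast; rfl
  have h3 := norm_sq_mul_volume_le hv _ (DifferentiableOn.fun_sum fun φ _ =>
    (holRep_differentiableOn φ.1).const_mul _) (coeFn_sum_smul_ae_eq a s)
  have hT' : ∑ φ ∈ s, ‖a φ‖ ^ 2 = T := by simp [ha, hT]
  rw [hnorm, hΨv, hT', Complex.norm_real, Real.norm_of_nonneg hT0] at h3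
  have hbpos : 0 < (volume (ball v r)).toReal :=
    ENNReal.toReal_pos (measure_ball_pos volume v hr).ne' measure_ball_lt_top.ne
  rw [← one_div, le_div_iff₀ hbpos]
  by_contra hcon
  push Not at hcon
  have hTpos : 0 < T := by
    rcases hT0.eq_or_lt with h0 | h0
    · rw [← h0] at hcon; linarith
    · exact h0
  nlinarith

theorem bergmanKernel_self (X : Set (Cn n)) (v : Cn n) :
    bergmanKernel X v v = ((∑' φ : bergmanBasis X, ‖holRep φ.1 v‖ ^ 2 : ℝ) : ℂ) := by
  rw [bergmanKernel, Complex.ofReal_tsum]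
  refine tsum_congr fun φ => ?_
  rw [Complex.mul_conj, Complex.normSq_eq_norm_sq]

/-- The Bergman kernel is smooth on the diagonal. -/
theorem contDiffOn_bergmanKernel {X : Set (Cn n)} (hX : IsOpen X) :
    ContDiffOn ℝ 2 (fun v => (bergmanKernel X v v).re) X := by
  intro x hx
  obtain ⟨R, hR, hRX⟩ := Metric.isOpen_iff.1 hX x hx
  set r := R / 3 with hr
  have hr0 : 0 < r := by positivity
  have hsub : ball x (2 * r) ⊆ X := (ball_subset_ball (by rw [hr]; linarith)).trans hRX
  -- On the diagonal the kernel is `‖Φ‖ ^ 2` for a holomorphic map `Φ` into `ℓ²`, so its smoothness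
  -- is that of `Φ`.
  obtain ⟨Φ, hΦd, hΦ⟩ := exists_differentiableOn_lp (S := bergmanBasis X)
    (φ := fun φ => holRep φ.1) (x := x) (r := r) (C := (volume (ball x r)).toReal⁻¹) hr0
    (fun φ => (holRep_differentiableOn φ.1).mono hsub) (fun v hv s => by
      have h1 : ball v r ⊆ X := (ball_subset_ball' (by
        have := mem_ball.1 hv; rw [hr] at this ⊢; linarith)).trans hRX
      have h2 := sum_norm_sq_holRep_le hr0 h1 s
      rwa [Measure.addHaar_ball_center, ← Measure.addHaar_ball_center volume x] at h2)
  have hr2 : 0 < r / 2 := by positivity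
  have h1 : ContDiffOn ℝ 2 (fun v => ‖Φ v‖ ^ 2) (ball x (r / 2)) :=
    ((contDiffOn_of_differentiableOn isOpen_ball hΦd 2).restrict_scalars ℝ).norm_sq ℂ
  have h2 : ContDiffOn ℝ 2 (fun v => (bergmanKernel X v v).re) (ball x (r / 2)) :=
    h1.congr fun v hv => by rw [bergmanKernel_self, Complex.ofReal_re, hΦ v hv]
  exact (h2.contDiffAt (ball_mem_nhds x hr2)).contDiffWithinAt

/-- Where the Bergman kernel is positive there is a nonvanishing element of the Bergman space. -/
theorem exists_holomorphic_ne_zero {X : Set (Cn n)} {x : Cn n}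
    (hx : 0 < (bergmanKernel X x x).re) :
    ∃ φ : Cn n → ℂ, DifferentiableOn ℂ φ X ∧ φ x ≠ 0 ∧ ∫⁻ y in X, ‖φ y‖ₑ ^ 2 ≠ ⊤ := by
  by_contra! hcon
  refine hx.ne' ?_
  rw [bergmanKernel_self, Complex.ofReal_re]
  have : ∀ φ : bergmanBasis X, ‖holRep φ.1 x‖ ^ 2 = 0 := by
    intro φ
    by_contra hne
    refine absurd (hcon (holRep φ.1) (holRep_differentiableOn φ.1) (by simpa using hne)) ?_
    rw [← lintegral_congr_ae (show (fun y =>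
      ‖(φ.1 : Lp ℂ 2 ((volume : Measure (Cn n)).restrict X)) y‖ₑ ^ 2) =ᵐ[volume.restrict X]
        fun y => ‖holRep φ.1 y‖ₑ ^ 2 by
        filter_upwards [holRep_ae_eq φ.1] with y hy; rw [hy]), lintegral_enorm_sq_Lp]
    exact ENNReal.ofReal_ne_top
  simp [this]

theorem continuousOn_fderiv_apply {f : Cn n → ℂ} {X : Set (Cn n)} {m : ℕ} (hX : IsOpen X)
    (hf : ContDiffOn ℝ (m + 1) f X) (v : Cn n) :
    ContDiffOn ℝ m (fun z => fderiv ℝ f z v) X :=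
  ((contDiffOn_succ_iff_fderiv_of_isOpen hX).1 hf).2.2.clm_apply contDiffOn_const

theorem contDiffOn_dzbar {f : Cn n → ℂ} {X : Set (Cn n)} {m : ℕ} (hX : IsOpen X)
    (hf : ContDiffOn ℝ (m + 1) f X) (μ : Fin n) : ContDiffOn ℝ m (dzbar μ f) X :=
  ((continuousOn_fderiv_apply hX hf _).add
    (contDiffOn_const.mul (continuousOn_fderiv_apply hX hf _))).div_const 2

theorem contDiffOn_dz {f : Cn n → ℂ} {X : Set (Cn n)} {m : ℕ} (hX : IsOpen X)
    (hf : ContDiffOn ℝ (m + 1) f X) (μ : Fin n) : ContDiffOn ℝ m (dz μ f) X :=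
  ((continuousOn_fderiv_apply hX hf _).sub
    (contDiffOn_const.mul (continuousOn_fderiv_apply hX hf _))).div_const 2

theorem continuousOn_bergmanTensor {X : Set (Cn n)} (hX : IsOpen X)
    (hpos : ∀ z ∈ X, 0 < (bergmanKernel X z z).re) (μ ν : Fin n) :
    ContinuousOn (bergmanTensor X μ ν) X := by
  have h1 : ContDiffOn ℝ 2 (fun v => ((Real.log (bergmanKernel X v v).re : ℝ) : ℂ)) X :=
    Complex.ofRealCLM.contDiff.comp_contDiffOn
      ((contDiffOn_bergmanKernel hX).log fun z hz => (hpos z hz).ne')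
  have h2 : ContDiffOn ℝ (1 : ℕ) (dzbar ν fun v => ((Real.log (bergmanKernel X v v).re : ℝ) : ℂ)) X :=
    contDiffOn_dzbar hX (by norm_num; exact h1) ν
  exact (contDiffOn_dz (m := 0) hX (by norm_num at h2 ⊢; exact h2) μ).continuousOn

/-- The Bergman metric is jointly continuous. -/
theorem continuousOn_bergmanMetric {X : Set (Cn n)} (hX : IsOpen X)
    (hpos : ∀ z ∈ X, 0 < (bergmanKernel X z z).re) :
    ContinuousOn (fun p : Cn n × Cn n => bergmanMetric X p.1 p.2) (X ×ˢ univ) := by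
  refine Real.continuous_sqrt.comp_continuousOn (Complex.continuous_re.comp_continuousOn ?_)
  refine continuousOn_finsetSum _ fun μ _ => continuousOn_finsetSum _ fun ν _ => ?_
  have h1 : ContinuousOn (fun p : Cn n × Cn n => bergmanTensor X μ ν p.1) (X ×ˢ univ) :=
    (continuousOn_bergmanTensor hX hpos μ ν).comp continuousOn_fst fun p hp => hp.1
  have h2 : Continuous fun p : Cn n × Cn n => p.2 μ := by fun_prop
  have h3 : Continuous fun p : Cn n × Cn n => (starRingEnd ℂ) (p.2 ν) :=
    Complex.continuous_conj.comp (by fun_prop)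
  exact (h1.mul h2.continuousOn).mul h3.continuousOn

theorem bergmanMetric_nonneg (X : Set (Cn n)) (z ξ : Cn n) : 0 ≤ bergmanMetric X z ξ :=
  Real.sqrt_nonneg _

theorem bergmanMetric_smul (X : Set (Cn n)) (z ξ : Cn n) (c : ℝ) :
    bergmanMetric X z (c • ξ) = |c| * bergmanMetric X z ξ := by
  have h : (∑ μ, ∑ ν, bergmanTensor X μ ν z * (c • ξ) μ * (starRingEnd ℂ) ((c • ξ) ν)) =
      ((c ^ 2 : ℝ) : ℂ) * ∑ μ, ∑ ν, bergmanTensor X μ ν z * ξ μ * (starRingEnd ℂ) (ξ ν) := by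
    simp_rw [Finset.mul_sum]
    refine Finset.sum_congr rfl fun μ _ => Finset.sum_congr rfl fun ν _ => ?_
    simp only [PiLp.smul_apply, Complex.real_smul, map_mul, Complex.conj_ofReal]
    push_cast; ring
  rw [bergmanMetric, h, Complex.re_ofReal_mul, Real.sqrt_mul (by positivity), Real.sqrt_sq_eq_abs]
  rfl

end Kernel

/-! ### Piecewise smooth curves and the topology of the Bergman distance. -/

section Curves

open Metric

variable {n : ℕ}

/-- A piecewise `C¹` curve in `X` that is parametrized by `[a, b]`. -/
structure IsCurveOn (X : Set (Cn n)) (γ : ℝ → Cn n) (a b : ℝ) : Prop where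
  le : a ≤ b
  mapsTo : MapsTo γ (Icc a b) X
  continuousOn : ContinuousOn γ (Icc a b)
  piecewise : ∃ (k : ℕ) (t : ℕ → ℝ), Monotone t ∧ t 0 = a ∧ t k = b ∧
    ∀ i < k, ContDiffOn ℝ 1 γ (Icc (t i) (t (i + 1)))

/-- The Bergman length of a curve parametrized by `[a, b]`. -/
noncomputable def bergmanLength (X : Set (Cn n)) (γ : ℝ → Cn n) (a b : ℝ) : ℝ :=
  ∫ t in a..b, bergmanMetric X (γ t) (deriv γ t)

theorem isPiecewiseC1Path_iff {X : Set (Cn n)} {z w : Cn n} {γ : ℝ → Cn n} :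
    IsPiecewiseC1Path X z w γ ↔ IsCurveOn X γ 0 1 ∧ γ 0 = z ∧ γ 1 = w :=
  ⟨fun h => ⟨⟨zero_le_one, h.mapsTo, h.continuousOn, h.piecewise⟩, h.source, h.target⟩,
    fun h => ⟨h.2.1, h.2.2, h.1.mapsTo, h.1.continuousOn, h.1.piecewise⟩⟩

theorem Icc_subset_of_monotone {t : ℕ → ℝ} (ht : Monotone t) {k i : ℕ} (hi : i < k) :
    Icc (t i) (t (i + 1)) ⊆ Icc (t 0) (t k) :=
  Icc_subset_Icc (ht (Nat.zero_le i)) (ht hi)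

theorem bergmanMetric_zero (X : Set (Cn n)) (z : Cn n) : bergmanMetric X z 0 = 0 := by
  simpa using bergmanMetric_smul X z 0 0

theorem bergmanMetric_neg (X : Set (Cn n)) (z ξ : Cn n) :
    bergmanMetric X z (-ξ) = bergmanMetric X z ξ := by
  simpa using bergmanMetric_smul X z ξ (-1)

theorem continuousOn_comp_prodMk {E : Type*} [TopologicalSpace E] {X : Set E} {F : E × E → ℝ}
    (h : ContinuousOn F (X ×ˢ univ)) {f g : ℝ → E} {s : Set ℝ}
    (hf : ContinuousOn f s) (hg : ContinuousOn g s) (hfX : MapsTo f s X) :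
    ContinuousOn (fun t => F (f t, g t)) s :=
  h.comp (hf.prodMk hg) fun _ ht => ⟨hfX ht, mem_univ _⟩

namespace IsCurveOn

variable {X : Set (Cn n)} {γ γ' : ℝ → Cn n} {a b c : ℝ}

theorem congr (h : IsCurveOn X γ a b) (hγ : EqOn γ' γ (Icc a b)) : IsCurveOn X γ' a b := by
  obtain ⟨k, t, hm, h0, hk, hC⟩ := h.piecewise
  refine ⟨h.le, fun s hs => by rw [hγ hs]; exact h.mapsTo hs, h.continuousOn.congr hγ,
    k, t, hm, h0, hk, fun i hi => (hC i hi).congr fun s hs => hγ ?_⟩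
  have := Icc_subset_of_monotone hm hi hs
  rwa [h0, hk] at this

theorem trans (h₁ : IsCurveOn X γ a b) (h₂ : IsCurveOn X γ b c) : IsCurveOn X γ a c := by
  obtain ⟨k₁, t₁, hm₁, h0₁, hk₁, hC₁⟩ := h₁.piecewise
  obtain ⟨k₂, t₂, hm₂, h0₂, hk₂, hC₂⟩ := h₂.piecewise
  have hun : Icc a c = Icc a b ∪ Icc b c := (Icc_union_Icc_eq_Icc h₁.le h₂.le).symm
  refine ⟨h₁.le.trans h₂.le, ?_, ?_, k₁ + k₂, fun i => if i ≤ k₁ then t₁ i else t₂ (i - k₁),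
    ?_, ?_, ?_, ?_⟩
  · rw [hun]; exact h₁.mapsTo.union h₂.mapsTo
  · rw [hun]; exact h₁.continuousOn.union_of_isClosed h₂.continuousOn isClosed_Icc isClosed_Icc
  · intro i j hij
    dsimp only
    split_ifs with h1 h2 h2
    · exact hm₁ hij
    · exact (hm₁ h1).trans (by rw [hk₁, ← h0₂]; exact hm₂ (Nat.zero_le _))
    · omega
    · exact hm₂ (by omega)
  · simpa using h0₁
  · rcases Nat.eq_zero_or_pos k₂ with rfl | hpos
    · simp only [add_zero, le_refl, if_true]
      rw [hk₁, ← h0₂, hk₂]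
    · dsimp only
      rw [if_neg (by omega), Nat.add_sub_cancel_left, hk₂]
  · intro i hi
    dsimp only
    rcases lt_or_ge i k₁ with h1 | h1
    · rw [if_pos h1.le, if_pos (by omega)]
      exact hC₁ i h1
    · have h2 : (if i ≤ k₁ then t₁ i else t₂ (i - k₁)) = t₂ (i - k₁) := by
        split_ifs with h3
        · have : i = k₁ := le_antisymm h3 h1
          rw [this, Nat.sub_self, hk₁, h0₂]
        · rfl
      rw [h2, if_neg (by omega), Nat.sub_add_comm h1]
      exact hC₂ _ (by omega)

theorem left (h : IsCurveOn X γ a b) (hc : c ∈ Icc a b) : IsCurveOn X γ a c := by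
  obtain ⟨k, t, hm, h0, hk, hC⟩ := h.piecewise
  have hsub : Icc a c ⊆ Icc a b := Icc_subset_Icc_right hc.2
  refine ⟨hc.1, h.mapsTo.mono_left hsub, h.continuousOn.mono hsub, k, fun i => min (t i) c,
    fun i j hij => min_le_min_right c (hm hij), ?_, ?_, fun i hi => ?_⟩
  · dsimp only; rw [h0, min_eq_left hc.1]
  · dsimp only; rw [hk, min_eq_right hc.2]
  · dsimp only
    rcases le_total (t i) c with h1 | h1
    · rw [min_eq_left h1]
      exact (hC i hi).mono (Icc_subset_Icc_right (min_le_left _ _))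
    -- Pieces of the partition beyond `c` collapse to the single point `c`.
    · rw [min_eq_right h1, min_eq_right (h1.trans (hm (Nat.le_succ i))), Icc_self]
      rintro s rfl
      exact contDiffWithinAt_singleton

theorem comp_mul_add {α : ℝ} (hα : 0 < α) {β : ℝ} (h : IsCurveOn X γ (α * a + β) (α * b + β)) :
    IsCurveOn X (fun s => γ (α * s + β)) a b := by
  obtain ⟨k, t, hm, h0, hk, hC⟩ := h.piecewise
  have hmaps : ∀ c d : ℝ, MapsTo (fun s => α * s + β) (Icc c d) (Icc (α * c + β) (α * d + β)) := by
    intro c d s hs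
    exact ⟨by nlinarith [hs.1], by nlinarith [hs.2]⟩
  refine ⟨?_, h.mapsTo.comp (hmaps a b), h.continuousOn.comp (by fun_prop) (hmaps a b), k,
    fun i => (t i - β) / α, fun i j hij => ?_, ?_, ?_, fun i hi => ?_⟩
  · have := h.le
    nlinarith
  · dsimp only; gcongr; exact hm hij
  · dsimp only; rw [h0]; field_simp; ring
  · dsimp only; rw [hk]; field_simp; ring
  · refine (hC i hi).comp (by fun_prop) ?_
    have h1 := hmaps ((t i - β) / α) ((t (i + 1) - β) / α)
    have h2 : ∀ x : ℝ, α * ((x - β) / α) + β = x := fun x => by field_simp; ring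
    rwa [h2, h2] at h1

theorem reverse (h : IsCurveOn X γ a b) : IsCurveOn X (fun s => γ (a + b - s)) a b := by
  obtain ⟨k, t, hm, h0, hk, hC⟩ := h.piecewise
  have hmaps : MapsTo (fun s => a + b - s) (Icc a b) (Icc a b) := fun s hs =>
    ⟨by linarith [hs.2], by linarith [hs.1]⟩
  refine ⟨h.le, h.mapsTo.comp hmaps, h.continuousOn.comp (by fun_prop) hmaps, k,
    fun i => a + b - t (k - i), fun i j hij => ?_, ?_, ?_, fun i hi => ?_⟩
  · dsimp only
    have := hm (show k - j ≤ k - i by omega)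
    linarith
  · simp [hk]
  · simp [h0]
  · refine (hC (k - (i + 1)) (by omega)).comp (by fun_prop) fun s hs => ?_
    have h1 : k - (i + 1) + 1 = k - i := by omega
    rw [h1]
    exact ⟨by linarith [hs.2], by linarith [hs.1]⟩

theorem intervalIntegrable (hX : IsOpen X) (hpos : ∀ z ∈ X, 0 < (bergmanKernel X z z).re)
    (h : IsCurveOn X γ a b) :
    IntervalIntegrable (fun t => bergmanMetric X (γ t) (deriv γ t)) volume a b := by
  obtain ⟨k, t, hm, h0, hk, hC⟩ := h.piecewise
  rw [← h0, ← hk]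
  refine IntervalIntegrable.trans_iterate fun i hi => ?_
  have hsub := Icc_subset_of_monotone hm hi
  rw [h0, hk] at hsub
  have hle : t i ≤ t (i + 1) := hm i.le_succ
  rcases hle.eq_or_lt with heq | hlt
  · exact heq ▸ IntervalIntegrable.refl
  -- At break points `deriv γ` may be a default value. The one-sided `derivWithin` is continuous on
  -- the closed piece and agrees with `deriv` in its interior.
  have hcont : ContinuousOn (fun s => bergmanMetric X (γ s)
      (derivWithin γ (Icc (t i) (t (i + 1))) s)) (Icc (t i) (t (i + 1))) := by
    have hder : ContinuousOn (derivWithin γ (Icc (t i) (t (i + 1)))) (Icc (t i) (t (i + 1))) :=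
      (hC i hi).continuousOn_derivWithin (uniqueDiffOn_Icc hlt) le_rfl
    have hcomp := continuousOn_comp_prodMk (continuousOn_bergmanMetric hX hpos)
      (h.continuousOn.mono hsub) hder fun s hs => h.mapsTo (hsub hs)
    exact hcomp
  refine (hcont.intervalIntegrable_of_Icc hlt.le).congr_uIoo fun s hs => ?_
  rw [uIoo_of_le hlt.le] at hs
  change bergmanMetric X (γ s) (derivWithin γ (Icc (t i) (t (i + 1))) s) = _
  rw [derivWithin_of_mem_nhds (Icc_mem_nhds hs.1 hs.2)]

end IsCurveOn

/-- Only the open interval matters: at the endpoints `deriv` sees values outside `[a, b]`, where the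
curves may differ. -/
theorem bergmanLength_congr {X : Set (Cn n)} {γ γ' : ℝ → Cn n} {a b : ℝ} (hab : a ≤ b)
    (hγ : EqOn γ' γ (Icc a b)) : bergmanLength X γ' a b = bergmanLength X γ a b := by
  refine intervalIntegral.integral_congr_uIoo fun s hs => ?_
  rw [uIoo_of_le hab] at hs
  have : γ' =ᶠ[𝓝 s] γ := by
    filter_upwards [Icc_mem_nhds hs.1 hs.2] with x hx using hγ hx
  rw [this.deriv_eq, this.eq_of_nhds]

theorem bergmanLength_comp_mul_add {X : Set (Cn n)} {γ : ℝ → Cn n} {a b α : ℝ} (hα : 0 < α)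
    (β : ℝ) : bergmanLength X (fun s => γ (α * s + β)) a b =
      bergmanLength X γ (α * a + β) (α * b + β) := by
  have h1 : ∀ s, deriv (fun s => γ (α * s + β)) s = α • deriv γ (α * s + β) := by
    intro s
    rw [deriv_comp_mul_left α (fun x => γ (x + β)), deriv_comp_add_const]
  simp only [bergmanLength, h1, bergmanMetric_smul, abs_of_pos hα]
  rw [intervalIntegral.integral_const_mul,
    intervalIntegral.integral_comp_mul_add (fun t => bergmanMetric X (γ t) (deriv γ t)) hα.ne',
    smul_eq_mul, mul_inv_cancel_left₀ hα.ne']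

theorem bergmanLength_reverse {X : Set (Cn n)} {γ : ℝ → Cn n} {a b : ℝ} :
    bergmanLength X (fun s => γ (a + b - s)) a b = bergmanLength X γ a b := by
  simp only [bergmanLength, deriv_comp_const_sub, bergmanMetric_neg]
  rw [intervalIntegral.integral_comp_sub_left (fun t => bergmanMetric X (γ t) (deriv γ t))]
  simp

theorem bergmanLength_nonneg {X : Set (Cn n)} {γ : ℝ → Cn n} {a b : ℝ} (hab : a ≤ b) :
    0 ≤ bergmanLength X γ a b :=
  intervalIntegral.integral_nonneg hab fun _ _ => bergmanMetric_nonneg _ _ _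

theorem bergmanLength_left_le {X : Set (Cn n)} {γ : ℝ → Cn n} {a b c : ℝ} (hX : IsOpen X)
    (hpos : ∀ z ∈ X, 0 < (bergmanKernel X z z).re) (h : IsCurveOn X γ a b) (hc : c ∈ Icc a b) :
    bergmanLength X γ a c ≤ bergmanLength X γ a b :=
  intervalIntegral.integral_mono_interval le_rfl hc.1 hc.2
    (Eventually.of_forall fun _ => bergmanMetric_nonneg _ _ _) (h.intervalIntegrable hX hpos)

/-- `z` and `w` are joined by a curve of length `L` in `X`. -/
def JoinedByLength (X : Set (Cn n)) (z w : Cn n) (L : ℝ) : Prop :=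
  ∃ (γ : ℝ → Cn n) (a b : ℝ), IsCurveOn X γ a b ∧ γ a = z ∧ γ b = w ∧ bergmanLength X γ a b = L

variable {X : Set (Cn n)}

theorem JoinedByLength.symm {z w : Cn n} {L : ℝ} (h : JoinedByLength X z w L) :
    JoinedByLength X w z L := by
  obtain ⟨γ, a, b, hγ, rfl, rfl, rfl⟩ := h
  exact ⟨_, a, b, hγ.reverse, by simp, by simp, bergmanLength_reverse⟩

theorem JoinedByLength.trans (hX : IsOpen X) (hpos : ∀ z ∈ X, 0 < (bergmanKernel X z z).re)
    {x y z : Cn n} {L L' : ℝ} (h : JoinedByLength X x y L) (h' : JoinedByLength X y z L') :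
    JoinedByLength X x z (L + L') := by
  obtain ⟨γ, a, b, hγ, rfl, rfl, rfl⟩ := h
  obtain ⟨δ, c, d, hδ, hδc, rfl, rfl⟩ := h'
  -- The second curve is translated to start at time `b`; the factor `1` puts the translation in the
  -- form `α * s + β`.
  have hshift : IsCurveOn X (fun s => δ (1 * s + (c - b))) b (b + (d - c)) := by
    refine IsCurveOn.comp_mul_add one_pos ?_
    convert hδ using 1 <;> ring
  have hlen : bergmanLength X (fun s => δ (1 * s + (c - b))) b (b + (d - c)) =
      bergmanLength X δ c d := by
    rw [bergmanLength_comp_mul_add one_pos]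
    congr 1 <;> ring
  set σ : ℝ → Cn n := fun s => if s ≤ b then γ s else δ (1 * s + (c - b)) with hσ
  have h1 : EqOn σ γ (Icc a b) := fun s hs => if_pos hs.2
  have h2 : EqOn σ (fun s => δ (1 * s + (c - b))) (Icc b (b + (d - c))) := by
    intro s hs
    rcases hs.1.eq_or_lt with rfl | hlt
    · simp [hσ, hδc]
    · exact if_neg hlt.not_ge
  have hc1 := hγ.congr h1
  have hc2 := hshift.congr h2
  refine ⟨σ, a, b + (d - c), hc1.trans hc2, h1 (left_mem_Icc.2 hγ.le), ?_, ?_⟩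
  · rw [h2 (right_mem_Icc.2 hshift.le)]
    dsimp only; congr 1; ring
  · rw [← hlen, ← bergmanLength_congr hγ.le h1, ← bergmanLength_congr hshift.le h2]
    exact (intervalIntegral.integral_add_adjacent_intervals (hc1.intervalIntegrable hX hpos)
      (hc2.intervalIntegrable hX hpos)).symm

theorem JoinedByLength.refl {z : Cn n} (hz : z ∈ X) : JoinedByLength X z z 0 := by
  refine ⟨fun _ => z, 0, 0, ⟨le_rfl, fun _ _ => hz, continuousOn_const, 0, fun _ => 0,
    monotone_const, rfl, rfl, fun i hi => by omega⟩, rfl, rfl, by simp [bergmanLength]⟩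

theorem bergmanDist_nonneg (z w : Cn n) : 0 ≤ bergmanDist X z w := by
  refine Real.sInf_nonneg ?_
  rintro _ ⟨γ, -, rfl⟩
  exact bergmanLength_nonneg zero_le_one

theorem bergmanDist_le_of_joined {z w : Cn n} {L : ℝ} (h : JoinedByLength X z w L) :
    bergmanDist X z w ≤ L := by
  have hbdd : BddBelow {L | ∃ γ : ℝ → Cn n, IsPiecewiseC1Path X z w γ ∧
      L = ∫ t in (0 : ℝ)..1, bergmanMetric X (γ t) (deriv γ t)} := by
    refine ⟨0, ?_⟩
    rintro _ ⟨γ, -, rfl⟩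
    exact bergmanLength_nonneg zero_le_one
  obtain ⟨γ, a, b, hγ, rfl, rfl, rfl⟩ := h
  rcases hγ.le.eq_or_lt with rfl | hab
  · refine csInf_le hbdd ⟨fun _ => γ a, ⟨rfl, rfl,
      fun _ _ => hγ.mapsTo (left_mem_Icc.2 le_rfl), continuousOn_const, 1, fun i => min i 1, ?_,
        by simp, by simp, fun i _ => contDiffOn_const⟩, ?_⟩
    · intro i j hij
      exact min_le_min_right 1 (by exact_mod_cast hij)
    · simp [bergmanLength, bergmanMetric_zero]
  · refine csInf_le hbdd ⟨fun s => γ ((b - a) * s + a), isPiecewiseC1Path_iff.2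
      ⟨IsCurveOn.comp_mul_add (sub_pos.2 hab) (by simpa using hγ), by simp, by simp⟩, ?_⟩
    have := bergmanLength_comp_mul_add (X := X) (γ := γ) (a := 0) (b := 1) (sub_pos.2 hab) a
    simpa [bergmanLength] using this.symm

/-- Since `sInf ∅ = 0`, a small distance alone yields no curve; the existence of a joining curve is
a separate input, supplied by connectedness of `X`. -/
theorem exists_joined_of_bergmanDist_lt {z w : Cn n} {r : ℝ} (hj : ∃ L, JoinedByLength X z w L)
    (h : bergmanDist X z w < r) : ∃ L < r, JoinedByLength X z w L := by
  have hne : {L | ∃ γ : ℝ → Cn n, IsPiecewiseC1Path X z w γ ∧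
      L = ∫ t in (0 : ℝ)..1, bergmanMetric X (γ t) (deriv γ t)}.Nonempty := by
    obtain ⟨_, γ, a, b, hγ, rfl, rfl, rfl⟩ := hj
    rcases hγ.le.eq_or_lt with rfl | hab
    · refine ⟨_, fun _ => γ a, ⟨rfl, rfl,
        fun _ _ => hγ.mapsTo (left_mem_Icc.2 le_rfl), continuousOn_const, 1, fun i => min i 1, ?_,
          by simp, by simp, fun i _ => contDiffOn_const⟩, rfl⟩
      intro i j hij
      exact min_le_min_right 1 (by exact_mod_cast hij)
    · exact ⟨_, fun s => γ ((b - a) * s + a), isPiecewiseC1Path_iff.2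
        ⟨IsCurveOn.comp_mul_add (sub_pos.2 hab) (by simpa using hγ), by simp, by simp⟩, rfl⟩
  obtain ⟨_, ⟨γ, hγ, rfl⟩, hlt⟩ := exists_lt_of_csInf_lt hne h
  obtain ⟨h1, h2, h3⟩ := isPiecewiseC1Path_iff.1 hγ
  exact ⟨_, hlt, γ, 0, 1, h1, h2, h3, rfl⟩

theorem bergmanDist_le_of_mem_curve {γ : ℝ → Cn n} {a b c : ℝ} (hX : IsOpen X)
    (hpos : ∀ z ∈ X, 0 < (bergmanKernel X z z).re) (h : IsCurveOn X γ a b) (hc : c ∈ Icc a b) :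
    bergmanDist X (γ a) (γ c) ≤ bergmanLength X γ a b :=
  (bergmanDist_le_of_joined ⟨γ, a, c, h.left hc, rfl, rfl, rfl⟩).trans
    (bergmanLength_left_le hX hpos h hc)

/-- The Bergman metric is locally bounded by the Euclidean norm. -/
theorem exists_bergmanMetric_le (hX : IsOpen X) (hpos : ∀ z ∈ X, 0 < (bergmanKernel X z z).re)
    {x : Cn n} (hx : x ∈ X) :
    ∃ r > 0, ball x r ⊆ X ∧ ∃ C, 0 ≤ C ∧
      ∀ y ∈ ball x r, ∀ ξ, bergmanMetric X y ξ ≤ C * ‖ξ‖ := by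
  obtain ⟨r, hr, hrX⟩ := Metric.nhds_basis_closedBall.mem_iff.1 (hX.mem_nhds hx)
  obtain ⟨C, hC⟩ := ((isCompact_closedBall x r).prod
    (isCompact_closedBall (0 : Cn n) 1)).exists_bound_of_continuousOn
      ((continuousOn_bergmanMetric hX hpos).mono (prod_mono hrX (subset_univ _)))
  have hC0 : 0 ≤ C := (norm_nonneg _).trans
    (hC (x, 0) ⟨mem_closedBall_self hr.le, mem_closedBall_self zero_le_one⟩)
  refine ⟨r, hr, ball_subset_closedBall.trans hrX, C, hC0, fun y hy ξ => ?_⟩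
  rcases eq_or_ne ξ 0 with rfl | hξ
  · simp [bergmanMetric_zero]
  have hξ0 : 0 < ‖ξ‖ := norm_pos_iff.2 hξ
  have h1 := hC (y, ‖ξ‖⁻¹ • ξ) ⟨ball_subset_closedBall hy, by
    rw [mem_closedBall, dist_zero_right, norm_smul, norm_inv, norm_norm,
      inv_mul_cancel₀ hξ0.ne']⟩
  rw [Real.norm_of_nonneg (bergmanMetric_nonneg _ _ _), bergmanMetric_smul,
    abs_of_pos (inv_pos.2 hξ0), inv_mul_le_iff₀ hξ0] at h1
  linarith

theorem joinedByLength_segment {x y y' : Cn n} {r C : ℝ} (hrX : ball x r ⊆ X)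
    (hC : ∀ y ∈ ball x r, ∀ ξ, bergmanMetric X y ξ ≤ C * ‖ξ‖) (hy : y ∈ ball x r)
    (hy' : y' ∈ ball x r) : ∃ L ≤ C * ‖y' - y‖, JoinedByLength X y y' L := by
  have hmem : MapsTo (fun s : ℝ => y + s • (y' - y)) (Icc 0 1) (ball x r) := fun s hs =>
    (convex_ball x r).add_smul_sub_mem hy hy' hs
  have hsm : ContDiff ℝ 1 fun s : ℝ => y + s • (y' - y) := by fun_prop
  refine ⟨_, ?_, fun s => y + s • (y' - y), 0, 1, ⟨zero_le_one, hmem.mono_right hrX,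
    hsm.continuous.continuousOn, 1, fun i => min i 1, ?_, by simp, by simp,
    fun i _ => hsm.contDiffOn⟩, by simp, by simp, rfl⟩
  · have hd : ∀ s : ℝ, deriv (fun s : ℝ => y + s • (y' - y)) s = y' - y := fun s => by
      have : HasDerivAt (fun s : ℝ => y + s • (y' - y)) ((1 : ℝ) • (y' - y)) s :=
        ((hasDerivAt_id s).smul_const (y' - y)).const_add y
      simpa using this.deriv
    have h1 := intervalIntegral.norm_integral_le_of_norm_le_const (a := 0) (b := 1)
      (C := C * ‖y' - y‖)
      (f := fun s => bergmanMetric X (y + s • (y' - y)) (deriv (fun s : ℝ => y + s • (y' - y)) s))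
      fun s hs => by
        rw [uIoc_of_le zero_le_one] at hs
        rw [Real.norm_of_nonneg (bergmanMetric_nonneg _ _ _), hd]
        exact hC _ (hmem ⟨hs.1.le, hs.2⟩) _
    have h2 := (le_abs_self _).trans h1
    rwa [sub_zero, abs_one, mul_one] at h2
  · intro i j hij
    exact min_le_min_right 1 (by exact_mod_cast hij)

/-- Any two points of a domain are joined by a curve. -/
theorem exists_joinedByLength (hX : IsOpen X) (hXc : IsPreconnected X)
    (hpos : ∀ z ∈ X, 0 < (bergmanKernel X z z).re) {z w : Cn n} (hz : z ∈ X) (hw : w ∈ X) :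
    ∃ L, JoinedByLength X z w L := by
  -- The points reachable from `z` form an open and relatively closed subset, because segments join
  -- all points of a small ball.
  have hsub : X ⊆ {w | w ∈ X ∧ ∃ L, JoinedByLength X z w L} := by
    refine hXc.subset_of_closure_inter_subset ?_ ⟨z, hz, hz, 0, .refl hz⟩ ?_
    · rw [Metric.isOpen_iff]
      rintro x ⟨hx, L, hL⟩
      obtain ⟨r, hr, hrX, C, -, hC⟩ := exists_bergmanMetric_le hX hpos hx
      refine ⟨r, hr, fun y hy => ⟨hrX hy, ?_⟩⟩
      obtain ⟨L', -, hL'⟩ := joinedByLength_segment hrX hC (mem_ball_self hr) hy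
      exact ⟨_, hL.trans hX hpos hL'⟩
    · rintro x ⟨hxc, hx⟩
      obtain ⟨r, hr, hrX, C, -, hC⟩ := exists_bergmanMetric_le hX hpos hx
      obtain ⟨y, ⟨-, L, hL⟩, hyr⟩ := Metric.mem_closure_iff.1 hxc r hr
      obtain ⟨L', -, hL'⟩ := joinedByLength_segment hrX hC
        (show y ∈ ball x r by rwa [mem_ball, dist_comm]) (mem_ball_self hr)
      exact ⟨hx, _, hL.trans hX hpos hL'⟩
  exact (hsub hw).2

theorem bergmanDist_self {z : Cn n} (hz : z ∈ X) : bergmanDist X z z = 0 :=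
  le_antisymm (bergmanDist_le_of_joined (.refl hz)) (bergmanDist_nonneg z z)

theorem bergmanDist_comm (hX : IsOpen X) (hXc : IsPreconnected X)
    (hpos : ∀ z ∈ X, 0 < (bergmanKernel X z z).re) {z w : Cn n} (hz : z ∈ X) (hw : w ∈ X) :
    bergmanDist X z w = bergmanDist X w z := by
  have key : ∀ {z w : Cn n}, z ∈ X → w ∈ X → bergmanDist X z w ≤ bergmanDist X w z := by
    intro z w hz hw
    refine le_of_forall_gt fun r hr => ?_
    obtain ⟨L, hL, hj⟩ := exists_joined_of_bergmanDist_lt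
      (exists_joinedByLength hX hXc hpos hw hz) hr
    exact (bergmanDist_le_of_joined hj.symm).trans_lt hL
  exact le_antisymm (key hz hw) (key hw hz)

theorem bergmanDist_triangle (hX : IsOpen X) (hXc : IsPreconnected X)
    (hpos : ∀ z ∈ X, 0 < (bergmanKernel X z z).re) {x y z : Cn n} (hx : x ∈ X) (hy : y ∈ X)
    (hz : z ∈ X) : bergmanDist X x z ≤ bergmanDist X x y + bergmanDist X y z := by
  refine le_of_forall_pos_le_add fun ε hε => ?_
  obtain ⟨L, hL, hj⟩ := exists_joined_of_bergmanDist_lt (r := bergmanDist X x y + ε / 2)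
    (exists_joinedByLength hX hXc hpos hx hy) (by linarith)
  obtain ⟨L', hL', hj'⟩ := exists_joined_of_bergmanDist_lt (r := bergmanDist X y z + ε / 2)
    (exists_joinedByLength hX hXc hpos hy hz) (by linarith)
  have := bergmanDist_le_of_joined (hj.trans hX hpos hj')
  linarith

/-- The Bergman pseudodistance is continuous for the Euclidean topology. -/
theorem continuousOn_bergmanDist (hX : IsOpen X) (hXc : IsPreconnected X)
    (hpos : ∀ z ∈ X, 0 < (bergmanKernel X z z).re) {p : Cn n} (hp : p ∈ X) :
    ContinuousOn (bergmanDist X p) X := by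
  intro x hx
  refine ContinuousAt.continuousWithinAt ?_
  obtain ⟨r, hr, hrX, C, hC0, hC⟩ := exists_bergmanMetric_le hX hpos hx
  have hle : ∀ y ∈ ball x r, |bergmanDist X p y - bergmanDist X p x| ≤ C * ‖y - x‖ := by
    intro y hy
    obtain ⟨L, hL, hj⟩ := joinedByLength_segment hrX hC (mem_ball_self hr) hy
    have h1 := (bergmanDist_le_of_joined hj).trans hL
    have h2 := bergmanDist_triangle hX hXc hpos hp hx (hrX hy)
    have h3 := bergmanDist_triangle hX hXc hpos hp (hrX hy) hx
    rw [bergmanDist_comm hX hXc hpos (hrX hy) hx] at h3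
    rw [abs_le]
    constructor <;> linarith
  rw [ContinuousAt, tendsto_iff_norm_sub_tendsto_zero]
  refine squeeze_zero' (g := fun y => C * ‖y - x‖) (Eventually.of_forall fun _ => norm_nonneg _)
    ?_ ?_
  · filter_upwards [ball_mem_nhds x hr] with y hy using hle y hy
  · have : Continuous fun y : Cn n => C * ‖y - x‖ := by fun_prop
    simpa using this.tendsto x

theorem isOpen_bergmanBall (hX : IsOpen X) (hXc : IsPreconnected X)
    (hpos : ∀ z ∈ X, 0 < (bergmanKernel X z z).re) {p : Cn n} (hp : p ∈ X) (r : ℝ) :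
    IsOpen (bergmanBall X p r) :=
  (continuousOn_bergmanDist hX hXc hpos hp).isOpen_inter_preimage hX isOpen_Iio

theorem mem_bergmanBall_self {p : Cn n} (hp : p ∈ X) {r : ℝ} (hr : 0 < r) :
    p ∈ bergmanBall X p r :=
  ⟨hp, by rwa [bergmanDist_self hp]⟩

/-- A curve from `p` of length less than `r` never leaves the ball, since its initial arcs are no
longer than the whole. Connectedness lets Hurwitz's theorem and the maximum principle run on Bergman
balls. -/
theorem isPreconnected_bergmanBall (hX : IsOpen X) (hXc : IsPreconnected X)
    (hpos : ∀ z ∈ X, 0 < (bergmanKernel X z z).re) {p : Cn n} (hp : p ∈ X) (r : ℝ) :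
    IsPreconnected (bergmanBall X p r) := by
  refine isPreconnected_of_forall p fun w hw => ?_
  obtain ⟨_, hL, γ, a, b, hγ, rfl, rfl, rfl⟩ := exists_joined_of_bergmanDist_lt
    (exists_joinedByLength hX hXc hpos hp hw.1) hw.2
  refine ⟨γ '' Icc a b, ?_, mem_image_of_mem _ (left_mem_Icc.2 hγ.le),
    mem_image_of_mem _ (right_mem_Icc.2 hγ.le), isPreconnected_Icc.image _ hγ.continuousOn⟩
  rintro _ ⟨s, hs, rfl⟩
  exact ⟨hγ.mapsTo hs, (bergmanDist_le_of_mem_curve hX hpos hγ hs).trans_lt hL⟩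

/-- Small Bergman balls are contained in small Euclidean balls. -/
theorem exists_bergmanBall_subset_ball (hX : IsOpen X) (hXc : IsPreconnected X)
    (hd : BergmanDistIsDistance X) {x : Cn n} (hx : x ∈ X) {ε : ℝ} (hε : 0 < ε)
    (hεX : closedBall x ε ⊆ X) :
    ∃ δ > 0, bergmanBall X x δ ⊆ ball x ε := by
  -- Separation of points enters here: on the compact sphere the distance from `x` has a positive
  -- lower bound, and a curve that leaves the Euclidean ball must cross the sphere.
  have hsph : ∀ y ∈ sphere x ε, 0 < bergmanDist X x y := by
    intro y hy
    refine (bergmanDist_nonneg x y).lt_of_ne fun h0 => ?_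
    exact ne_of_mem_sphere hy hε.ne' (hd.separates x hx y (hεX (sphere_subset_closedBall hy))
      h0.symm).symm
  obtain ⟨δ, hδ, hle⟩ := (isCompact_sphere x ε).exists_forall_le'
    ((continuousOn_bergmanDist hX hXc hd.kernel_pos hx).mono
      (sphere_subset_closedBall.trans hεX)) hsph
  refine ⟨δ, hδ, fun w hw => ?_⟩
  by_contra hwε
  obtain ⟨_, hL, γ, a, b, hγ, rfl, rfl, rfl⟩ := exists_joined_of_bergmanDist_lt
    (exists_joinedByLength hX hXc hd.kernel_pos hx hw.1) hw.2
  have hcont : ContinuousOn (fun s => dist (γ s) (γ a)) (Icc a b) :=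
    continuous_dist.comp_continuousOn (hγ.continuousOn.prodMk continuousOn_const)
  obtain ⟨s, hs, hsε⟩ := intermediate_value_Icc hγ.le hcont
    (show ε ∈ Icc (dist (γ a) (γ a)) (dist (γ b) (γ a)) from
      ⟨by simpa using hε.le, not_lt.1 hwε⟩)
  have h1 := hle (γ s) hsε
  have h2 := bergmanDist_le_of_mem_curve hX hd.kernel_pos hγ hs
  linarith

end Curves

/-! ### Transitivity of the automorphism group of the ball. -/

section BallAutomorphism

open Metric

variable {n : ℕ}

/-- The automorphism of the unit ball that interchanges `0` and `a`. -/
noncomputable def ballInvolution (a z : Cn n) : Cn n :=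
  (1 - inner ℂ a z)⁻¹ •
    ((1 - (((1 + √(1 - ‖a‖ ^ 2))⁻¹ : ℝ) : ℂ) * inner ℂ a z) • a - ((√(1 - ‖a‖ ^ 2) : ℝ) : ℂ) • z)

theorem norm_inner_lt_one {a z : Cn n} (ha : ‖a‖ < 1) (hz : ‖z‖ < 1) : ‖inner ℂ a z‖ < 1 := by
  refine (norm_inner_le_norm a z).trans_lt ?_
  nlinarith [norm_nonneg a, norm_nonneg z]

theorem one_sub_inner_ne_zero {a z : Cn n} (ha : ‖a‖ < 1) (hz : ‖z‖ < 1) :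
    1 - inner ℂ a z ≠ 0 := by
  intro h
  have h1 := norm_inner_lt_one ha hz
  rw [← sub_eq_zero.1 h, norm_one] at h1
  exact lt_irrefl _ h1

theorem ballInvolution_zero (a : Cn n) : ballInvolution a 0 = a := by
  simp [ballInvolution]

theorem differentiableOn_ballInvolution {a : Cn n} (ha : ‖a‖ < 1) :
    DifferentiableOn ℂ (ballInvolution a) (unitBall n) := by
  have h1 : DifferentiableOn ℂ (fun z : Cn n => inner ℂ a z) (unitBall n) :=
    (innerSL ℂ a).differentiable.differentiableOn
  refine DifferentiableOn.fun_smul ((h1.const_sub 1).fun_inv fun z hz => ?_) ?_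
  · exact one_sub_inner_ne_zero ha (by simpa using hz)
  · exact (((h1.const_mul _).const_sub 1).smul_const a).sub
      (show Differentiable ℂ fun z : Cn n => ((√(1 - ‖a‖ ^ 2) : ℝ) : ℂ) • z by
        fun_prop).differentiableOn

/-- The classical formula for `1 - ‖φ_a(z)‖ ^ 2` with its denominator cleared. With `s = √(1 - ‖a‖ ^
2)`, the coefficient `(1 + s)⁻¹` is the usual `(1 - s) / ‖a‖ ^ 2`, rewritten so that `a = 0` needs
no separate case. -/
theorem norm_ballInvolution_numerator_sq {a : Cn n} (ha : ‖a‖ < 1) (z : Cn n) :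
    ‖(1 - (((1 + √(1 - ‖a‖ ^ 2))⁻¹ : ℝ) : ℂ) * inner ℂ a z) • a
      - ((√(1 - ‖a‖ ^ 2) : ℝ) : ℂ) • z‖ ^ 2 =
      ‖1 - inner ℂ a z‖ ^ 2 - (1 - ‖a‖ ^ 2) * (1 - ‖z‖ ^ 2) := by
  have hpos : 0 < 1 - ‖a‖ ^ 2 := by nlinarith [norm_nonneg a]
  have hs2 : √(1 - ‖a‖ ^ 2) ^ 2 = 1 - ‖a‖ ^ 2 := Real.sq_sqrt hpos.le
  have hs0 : 0 ≤ √(1 - ‖a‖ ^ 2) := Real.sqrt_nonneg _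
  set s := √(1 - ‖a‖ ^ 2) with hs
  have hc : (1 + s)⁻¹ * (1 + s) = 1 := inv_mul_cancel₀ (by positivity)
  set c := (1 + s)⁻¹ with hcdef
  set t : ℂ := inner ℂ a z with ht
  rw [norm_sub_sq (𝕜 := ℂ), inner_smul_left, inner_smul_right, ← ht, norm_smul, norm_smul,
    mul_pow, mul_pow, Complex.norm_real, Real.norm_of_nonneg hs0, ← Complex.normSq_eq_norm_sq,
    ← Complex.normSq_eq_norm_sq, Complex.normSq_apply, Complex.normSq_apply]
  have ha2 : ‖a‖ ^ 2 = 1 - s ^ 2 := by linarith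
  rw [ha2]
  simp only [map_sub, map_one, map_mul, Complex.conj_ofReal, RCLike.re_eq_complex_re,
    Complex.sub_re, Complex.sub_im, Complex.mul_re, Complex.mul_im, Complex.one_re, Complex.one_im,
    Complex.ofReal_re, Complex.ofReal_im, Complex.conj_re, Complex.conj_im]
  linear_combination (-2 * t.re * (1 - s) + c * (t.re ^ 2 + t.im ^ 2) * (1 - s)
    + (t.re ^ 2 + t.im ^ 2)) * hc

theorem norm_ballInvolution_lt_one {a z : Cn n} (ha : ‖a‖ < 1) (hz : ‖z‖ < 1) :
    ‖ballInvolution a z‖ < 1 := by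
  have h1 := norm_ballInvolution_numerator_sq ha z
  have h2 : 0 < ‖1 - inner ℂ a z‖ := norm_pos_iff.2 (one_sub_inner_ne_zero ha hz)
  rw [ballInvolution, norm_smul, norm_inv, inv_mul_lt_one₀ h2]
  refine lt_of_pow_lt_pow_left₀ 2 h2.le ?_
  rw [h1]
  have h3 : 0 < 1 - ‖a‖ ^ 2 := by nlinarith [norm_nonneg a]
  have h4 : 0 < 1 - ‖z‖ ^ 2 := by nlinarith [norm_nonneg z]
  nlinarith [mul_pos h3 h4]

theorem ballInvolution_ballInvolution {a z : Cn n} (ha : ‖a‖ < 1) (hz : ‖z‖ < 1) :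
    ballInvolution a (ballInvolution a z) = z := by
  have hne := one_sub_inner_ne_zero ha hz
  have hpos : 0 < 1 - ‖a‖ ^ 2 := by nlinarith [norm_nonneg a]
  have hs2 : √(1 - ‖a‖ ^ 2) ^ 2 = 1 - ‖a‖ ^ 2 := Real.sq_sqrt hpos.le
  have hs0 : 0 < √(1 - ‖a‖ ^ 2) := Real.sqrt_pos.2 hpos
  rw [ballInvolution, ballInvolution]
  set s := √(1 - ‖a‖ ^ 2) with hs
  have hc : (((1 + s)⁻¹ : ℝ) : ℂ) * (1 + (s : ℂ)) = 1 := by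
    rw [← Complex.ofReal_one, ← Complex.ofReal_add, ← Complex.ofReal_mul,
      inv_mul_cancel₀ (by positivity)]
  set c : ℂ := (((1 + s)⁻¹ : ℝ) : ℂ) with hcdef
  have hsC : (s : ℂ) ≠ 0 := by exact_mod_cast hs0.ne'
  have haa : inner ℂ a a = 1 - (s : ℂ) ^ 2 := by
    rw [inner_self_eq_norm_sq_to_K, ← Complex.ofReal_pow s, hs2]
    push_cast
    simp
  set t : ℂ := inner ℂ a z with ht
  have ht' : inner ℂ a ((1 - t)⁻¹ • ((1 - c * t) • a - (s : ℂ) • z)) =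
      (1 - t)⁻¹ * (1 - (s : ℂ) ^ 2 - t) := by
    rw [inner_smul_right, inner_sub_right, inner_smul_right, inner_smul_right, haa, ← ht]
    linear_combination (1 - t)⁻¹ * (-t * (1 - (s : ℂ))) * hc
  rw [ht']
  have h1 : 1 - (1 - t)⁻¹ * (1 - (s : ℂ) ^ 2 - t) = (s : ℂ) ^ 2 * (1 - t)⁻¹ := by
    field_simp; ring
  have h2 : 1 - c * ((1 - t)⁻¹ * (1 - (s : ℂ) ^ 2 - t)) = (s : ℂ) * ((1 - t)⁻¹ * (1 - c * t)) := by
    have : (1 - t)⁻¹ * (1 - t) = 1 := inv_mul_cancel₀ hne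
    linear_combination (-1 : ℂ) * this + (1 - t)⁻¹ * (t - (1 - (s : ℂ))) * hc
  rw [h1, h2, smul_sub (1 - t)⁻¹, smul_sub (s : ℂ), smul_smul (1 - t)⁻¹, smul_smul (s : ℂ),
    sub_sub_cancel]
  simp only [smul_smul]
  convert one_smul ℂ z using 2
  field_simp

end BallAutomorphism

/-! ### Charts modelled on the ball and their Jacobians. -/

section Charts

open Metric

variable {n : ℕ}

/-- `f` is a biholomorphic map of the unit ball onto the open set `W` of `X`, with inverse `g`. -/
structure IsBallChart (X : Set (Cn n)) (f g : Cn n → Cn n) (W : Set (Cn n)) : Prop where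
  isOpen : IsOpen W
  subset : W ⊆ X
  differentiableOn : DifferentiableOn ℂ f (unitBall n)
  differentiableOn_inv : DifferentiableOn ℂ g W
  mapsTo : MapsTo f (unitBall n) W
  mapsTo_inv : MapsTo g W (unitBall n)
  left_inv : ∀ z ∈ unitBall n, g (f z) = z
  right_inv : ∀ w ∈ W, f (g w) = w

theorem IsBallChart.isHolEmbedding {X : Set (Cn n)} {f g : Cn n → Cn n} {W : Set (Cn n)}
    (h : IsBallChart X f g W) : IsHolEmbedding f (unitBall n) X ∧ f '' unitBall n = W := by
  have himg : f '' unitBall n = W :=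
    Subset.antisymm (image_subset_iff.2 h.mapsTo) fun w hw =>
      ⟨g w, h.mapsTo_inv hw, h.right_inv w hw⟩
  refine ⟨⟨h.differentiableOn, fun z hz => h.subset (h.mapsTo hz), ?_, g, ?_, h.left_inv⟩, himg⟩
  · rw [himg]; exact h.isOpen
  · rw [himg]; exact h.differentiableOn_inv

theorem exists_isBallChart {X : Set (Cn n)} {f : Cn n → Cn n}
    (hf : IsHolEmbedding f (unitBall n) X) : ∃ g, IsBallChart X f g (f '' unitBall n) := by
  obtain ⟨g, hg, hgf⟩ := hf.inverse
  refine ⟨g, hf.isOpen_image, image_subset_iff.2 hf.mapsTo, hf.holomorphic, hg,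
    mapsTo_image f _, ?_, hgf, ?_⟩
  · rintro _ ⟨z, hz, rfl⟩
    rwa [hgf hz]
  · rintro _ ⟨z, hz, rfl⟩
    rw [hgf hz]

/-- A chart can be centred at any point of its image. -/
theorem IsBallChart.exists_centered {X : Set (Cn n)} {f g : Cn n → Cn n} {W : Set (Cn n)}
    (h : IsBallChart X f g W) {p : Cn n} (hp : p ∈ W) :
    ∃ f' g', IsBallChart X f' g' W ∧ f' 0 = p := by
  have ha : ‖g p‖ < 1 := by simpa using h.mapsTo_inv hp
  have hφ : MapsTo (ballInvolution (g p)) (unitBall n) (unitBall n) := fun z hz => by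
    simpa using norm_ballInvolution_lt_one ha (by simpa using hz)
  have hφφ : ∀ z ∈ unitBall n, ballInvolution (g p) (ballInvolution (g p) z) = z := fun z hz =>
    ballInvolution_ballInvolution ha (by simpa using hz)
  have hd := differentiableOn_ballInvolution ha
  refine ⟨fun z => f (ballInvolution (g p) z), fun w => ballInvolution (g p) (g w),
    ⟨h.isOpen, h.subset, h.differentiableOn.comp hd hφ,
      hd.comp h.differentiableOn_inv h.mapsTo_inv, fun z hz => h.mapsTo (hφ hz),
      fun w hw => hφ (h.mapsTo_inv hw), fun z hz => ?_, fun w hw => ?_⟩, ?_⟩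
  · rw [h.left_inv _ (hφ hz), hφφ z hz]
  · rw [hφφ _ (h.mapsTo_inv hw), h.right_inv w hw]
  · dsimp only
    rw [ballInvolution_zero, h.right_inv p hp]

theorem exists_centered_chart {X : Set (Cn n)} {p : Cn n} (hp : p ∈ X) {r : ℝ}
    (hr : r ∈ fridmanRadii X p) :
    ∃ f g W, IsBallChart X f g W ∧ f 0 = p ∧ bergmanBall X p r ⊆ W := by
  obtain ⟨hr0, f, hf, hsub⟩ := hr
  obtain ⟨g, hg⟩ := exists_isBallChart hf
  obtain ⟨f', g', h, h0⟩ := hg.exists_centered (hsub (mem_bergmanBall_self hp hr0))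
  exact ⟨f', g', _, h, h0, hsub⟩

/-- A Euclidean ball in `X` is a chart. -/
theorem isBallChart_ball {X : Set (Cn n)} {x : Cn n} {ε : ℝ} (hε : 0 < ε) (hX : ball x ε ⊆ X) :
    IsBallChart X (fun z => x + (ε : ℂ) • z) (fun w => (ε : ℂ)⁻¹ • (w - x)) (ball x ε) := by
  have hεC : (ε : ℂ) ≠ 0 := by exact_mod_cast hε.ne'
  refine ⟨isOpen_ball, hX, by fun_prop, by fun_prop, fun z hz => ?_, fun w hw => ?_,
    fun z _ => ?_, fun w _ => ?_⟩
  · rw [mem_ball, dist_eq_norm, add_sub_cancel_left, norm_smul, Complex.norm_real,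
      Real.norm_of_nonneg hε.le]
    rw [mem_ball, dist_zero_right] at hz
    nlinarith
  · rw [mem_ball, dist_zero_right, norm_smul, norm_inv, Complex.norm_real,
      Real.norm_of_nonneg hε.le, inv_mul_lt_one₀ hε, ← dist_eq_norm]
    exact hw
  · rw [add_sub_cancel_left, inv_smul_smul₀ hεC]
  · rw [smul_inv_smul₀ hεC, add_sub_cancel]

theorem IsBallChart.mem_fridmanRadii {X : Set (Cn n)} {f g : Cn n → Cn n} {W : Set (Cn n)}
    (h : IsBallChart X f g W) {p : Cn n} {r : ℝ} (hr : 0 < r) (hW : bergmanBall X p r ⊆ W) :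
    r ∈ fridmanRadii X p :=
  ⟨hr, f, h.isHolEmbedding.1, by rw [h.isHolEmbedding.2]; exact hW⟩

/-- A small Euclidean ball is an affine image of the unit ball and contains a Bergman ball. -/
theorem fridmanRadii_nonempty {X : Set (Cn n)} (hX : IsOpen X) (hXc : IsPreconnected X)
    (hd : BergmanDistIsDistance X) {x : Cn n} (hx : x ∈ X) : (fridmanRadii X x).Nonempty := by
  obtain ⟨ε, hε, hεX⟩ := Metric.nhds_basis_closedBall.mem_iff.1 (hX.mem_nhds hx)
  obtain ⟨δ, hδ, hsub⟩ := exists_bergmanBall_subset_ball hX hXc hd hx hε hεX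
  exact ⟨δ, (isBallChart_ball hε (ball_subset_closedBall.trans hεX)).mem_fridmanRadii hδ hsub⟩

theorem IsBallChart.det_inv_mul_det {X : Set (Cn n)} {f g : Cn n → Cn n} {W : Set (Cn n)}
    (h : IsBallChart X f g W) {z : Cn n} (hz : z ∈ unitBall n) :
    (fderiv ℂ g (f z)).det * (fderiv ℂ f z).det = 1 :=
  det_mul_det_eq_one ((h.differentiableOn z hz).differentiableAt (isOpen_ball.mem_nhds hz))
    ((h.differentiableOn_inv _ (h.mapsTo hz)).differentiableAt (h.isOpen.mem_nhds (h.mapsTo hz)))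
    (by filter_upwards [isOpen_ball.mem_nhds hz] with y hy using h.left_inv y hy)

theorem IsBallChart.det_ne_zero {X : Set (Cn n)} {f g : Cn n → Cn n} {W : Set (Cn n)}
    (h : IsBallChart X f g W) {z : Cn n} (hz : z ∈ unitBall n) : (fderiv ℂ f z).det ≠ 0 :=
  right_ne_zero_of_mul_eq_one (h.det_inv_mul_det hz)

theorem IsBallChart.det_inv_ne_zero {X : Set (Cn n)} {f g : Cn n → Cn n} {W : Set (Cn n)}
    (h : IsBallChart X f g W) {w : Cn n} (hw : w ∈ W) : (fderiv ℂ g w).det ≠ 0 := by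
  have := left_ne_zero_of_mul_eq_one (h.det_inv_mul_det (h.mapsTo_inv hw))
  rwa [h.right_inv w hw] at this

/-- The determinant is a holomorphic function. -/
theorem differentiable_det : Differentiable ℂ fun A : Cn n →L[ℂ] Cn n => A.det := by
  have h : (fun A : Cn n →L[ℂ] Cn n => A.det) = fun A => ∑ σ : Equiv.Perm (Fin n),
      ((Equiv.Perm.sign σ : ℤ) : ℂ) * ∏ i, A (EuclideanSpace.single i 1) (σ i) := by
    funext A
    rw [ContinuousLinearMap.det, ← LinearMap.det_toMatrix
      (EuclideanSpace.basisFun (Fin n) ℂ).toBasis, Matrix.det_apply']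
    refine Finset.sum_congr rfl fun σ _ => ?_
    simp [LinearMap.toMatrix_apply]
  rw [h]
  have h2 : ∀ i j : Fin n, Differentiable ℂ fun A : Cn n →L[ℂ] Cn n =>
      A (EuclideanSpace.single i 1) j := fun i j =>
    (EuclideanSpace.proj (𝕜 := ℂ) j).differentiable.comp
      (ContinuousLinearMap.apply ℂ (Cn n) (EuclideanSpace.single i (1 : ℂ))).differentiable
  refine Differentiable.fun_sum fun σ _ => Differentiable.const_mul ?_ _
  exact fun A => (HasFDerivAt.finsetProd (g := fun i (A : Cn n →L[ℂ] Cn n) =>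
    A (EuclideanSpace.single i 1) (σ i)) fun i _ =>
      ((h2 i (σ i)) A).hasFDerivAt).differentiableAt

theorem differentiableOn_det_fderiv {f : Cn n → Cn n} {U : Set (Cn n)} (hU : IsOpen U)
    (hf : DifferentiableOn ℂ f U) : DifferentiableOn ℂ (fun z => (fderiv ℂ f z).det) U :=
  differentiable_det.comp_differentiableOn (differentiableOn_fderiv hU hf)

/-- The Jacobian determinant of a chart is controlled by an element of the Bergman space. -/
theorem IsBallChart.enorm_sq_mul_volume_le {X : Set (Cn n)} {f g : Cn n → Cn n} {W : Set (Cn n)}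
    (h : IsBallChart X f g W) {φ : Cn n → ℂ} (hφ : DifferentiableOn ℂ φ X) :
    ‖φ (f 0)‖ₑ ^ 2 * volume (unitBall n) ≤
      (∫⁻ y in X, ‖φ y‖ₑ ^ 2) * ‖(fderiv ℂ g (f 0)).det‖ₑ ^ 2 := by
  have h0 : (0 : Cn n) ∈ unitBall n := mem_ball_self one_pos
  have hmX : MapsTo f (unitBall n) X := fun z hz => h.subset (h.mapsTo hz)
  -- The pullback of `φ` weighted by the Jacobian has the same `L²` norm as `φ` on the image of `f`.
  -- Its mean value inequality at `0` bounds `det f'(0)` above, hence `det g'(f 0)` below.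
  have hψ : DifferentiableOn ℂ (fun z => (fderiv ℂ f z).det * φ (f z)) (unitBall n) :=
    (differentiableOn_det_fderiv isOpen_ball h.differentiableOn).fun_mul
      (hφ.comp h.differentiableOn hmX)
  have h1 := enorm_sq_mul_volume_ball_le hψ
  have hinj : InjOn f (unitBall n) := fun z hz w hw hzw => by
    rw [← h.left_inv z hz, ← h.left_inv w hw, hzw]
  have h2 : ∫⁻ z in unitBall n, ‖(fderiv ℂ f z).det * φ (f z)‖ₑ ^ 2 ≤ ∫⁻ y in X, ‖φ y‖ₑ ^ 2 := by
    simp_rw [enorm_mul, mul_pow]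
    rw [← lintegral_image_holomorphic isOpen_ball h.differentiableOn hinj fun y => ‖φ y‖ₑ ^ 2]
    exact lintegral_mono_set (image_subset_iff.2 hmX)
  have h3 := h1.trans h2
  have h4 := h.det_inv_mul_det h0
  calc ‖φ (f 0)‖ₑ ^ 2 * volume (unitBall n)
      = ‖(fderiv ℂ g (f 0)).det * (fderiv ℂ f 0).det‖ₑ ^ 2 *
          (‖φ (f 0)‖ₑ ^ 2 * volume (unitBall n)) := by rw [h4]; simp
    _ = (‖(fderiv ℂ f 0).det * φ (f 0)‖ₑ ^ 2 * volume (unitBall n)) *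
          ‖(fderiv ℂ g (f 0)).det‖ₑ ^ 2 := by
        rw [enorm_mul, enorm_mul, mul_pow, mul_pow]; ring
    _ ≤ _ := by gcongr

end Charts

/-! ### Limits of charts; exhaustion by charts forces the ball. -/

section Limits

open Metric

variable {n : ℕ}

/-- Uniform continuity of `G` is not needed: since `f` is continuous, near `x` both `u k` and `f`
have values close to `f x`, and continuity of `G` there suffices. -/
theorem tendstoLocallyUniformlyOn_continuous_comp {α β γ ι : Type*} [TopologicalSpace α]
    [UniformSpace β] [UniformSpace γ] {l : Filter ι} {u : ι → α → β} {f : α → β} {s : Set α}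
    (hs : IsOpen s) (h : TendstoLocallyUniformlyOn u f l s) (hf : ContinuousOn f s) {G : β → γ}
    (hG : Continuous G) :
    TendstoLocallyUniformlyOn (fun k x => G (u k x)) (fun x => G (f x)) l s := by
  rw [hs.tendstoLocallyUniformlyOn_iff_forall_tendsto] at h ⊢
  intro x hx
  have h1 : Tendsto (fun y : ι × α => f y.2) (l ×ˢ 𝓝 x) (𝓝 (f x)) :=
    (hf.continuousAt (hs.mem_nhds hx)).tendsto.comp tendsto_snd
  have h2 : Tendsto (fun y : ι × α => u y.1 y.2) (l ×ˢ 𝓝 x) (𝓝 (f x)) :=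
    h1.congr_uniformity (h x hx)
  have h3 := ((hG.tendsto (f x)).comp h1).prodMk_nhds ((hG.tendsto (f x)).comp h2)
  exact h3.mono_right (nhds_le_uniformity _)

theorem tendstoLocallyUniformlyOn_det_fderiv {ι : Type*} {l : Filter ι} [l.NeBot]
    {u : ι → Cn n → Cn n} {f : Cn n → Cn n} {U : Set (Cn n)} (hU : IsOpen U)
    (hu : EventuallyHolomorphicOn l u U) (h : TendstoLocallyUniformlyOn u f l U) :
    TendstoLocallyUniformlyOn (fun k x => (fderiv ℂ (u k) x).det)
      (fun x => (fderiv ℂ f x).det) l U :=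
  tendstoLocallyUniformlyOn_continuous_comp hU (tendstoLocallyUniformlyOn_fderiv hU hu h)
    (differentiableOn_fderiv hU (differentiableOn_of_tendstoLocallyUniformlyOn hU hu h)).continuousOn
    differentiable_det.continuous

/-- Hurwitz' theorem for locally biholomorphic maps. -/
theorem det_fderiv_ne_zero_of_tendsto {ι : Type*} {l : Filter ι} [l.NeBot]
    {u : ι → Cn n → Cn n} {f : Cn n → Cn n} {U : Set (Cn n)} (hU : IsOpen U)
    (hUc : IsPreconnected U) (hu : EventuallyHolomorphicOn l u U)
    (h : TendstoLocallyUniformlyOn u f l U)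
    (hne : ∀ x ∈ U, ∃ δ > 0, ∀ᶠ k in l, ∀ y ∈ ball x δ, (fderiv ℂ (u k) y).det ≠ 0)
    {p : Cn n} (hp : p ∈ U) (hdet : (fderiv ℂ f p).det ≠ 0) :
    ∀ x ∈ U, (fderiv ℂ f x).det ≠ 0 := by
  refine ne_zero_of_tendstoLocallyUniformlyOn hU hUc (fun x hx => ?_)
    (tendstoLocallyUniformlyOn_det_fderiv hU hu h) hne ⟨p, hp, hdet⟩
  obtain ⟨δ, hδ, hk⟩ := hu x hx
  exact ⟨δ, hδ, hk.mono fun k hk => differentiableOn_det_fderiv isOpen_ball hk⟩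

/-- The inverses of centred charts subconverge where the images of the charts accumulate. -/
theorem exists_tendsto_chart_inverse {ι : Type*} (l : Ultrafilter ι) {X : Set (Cn n)}
    {f g : ι → Cn n → Cn n} {W : ι → Set (Cn n)} (h : ∀ k, IsBallChart X (f k) (g k) (W k))
    {p : Cn n} (h0 : ∀ k, f k 0 = p) {U : Set (Cn n)} (hU : IsOpen U) (hUc : IsPreconnected U)
    (hp : p ∈ U) (hW : ∀ x ∈ U, ∃ δ > 0, ∀ᶠ k in (l : Filter ι), ball x δ ⊆ W k) :
    EventuallyHolomorphicOn (l : Filter ι) g U ∧ ∃ G : Cn n → Cn n,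
      TendstoLocallyUniformlyOn g G l U ∧ DifferentiableOn ℂ G U ∧ G p = 0 ∧
      MapsTo G U (unitBall n) := by
  have hhol : EventuallyHolomorphicOn (l : Filter ι) g U := fun x hx => by
    obtain ⟨δ, hδ, hk⟩ := hW x hx
    exact ⟨δ, hδ, hk.mono fun k hk => (h k).differentiableOn_inv.mono hk⟩
  have hbd : ∀ x ∈ U, ∀ᶠ k in (l : Filter ι), ‖g k x‖ ≤ 1 := fun x hx => by
    obtain ⟨δ, hδ, hk⟩ := hW x hx
    filter_upwards [hk] with k hk
    exact (mem_ball_zero_iff.1 ((h k).mapsTo_inv (hk (mem_ball_self hδ)))).le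
  refine ⟨hhol, ?_⟩
  obtain ⟨G, hG⟩ := exists_tendstoLocallyUniformlyOn_of_bounded l (u := g) hU fun x hx => by
    obtain ⟨δ, hδ, hk⟩ := hW x hx
    refine ⟨δ, hδ, 1, hk.mono fun k hk => ⟨(h k).differentiableOn_inv.mono hk, fun y hy => ?_⟩⟩
    exact (mem_ball_zero_iff.1 ((h k).mapsTo_inv (hk hy))).le
  have hGd := differentiableOn_of_tendstoLocallyUniformlyOn hU hhol hG
  have hGp : G p = 0 := by
    refine tendsto_nhds_unique (hG.tendsto_at hp) ?_
    have : ∀ k, g k p = 0 := fun k => by rw [← h0 k, (h k).left_inv 0 (mem_ball_self one_pos)]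
    simp [this]
  refine ⟨G, hG, hGd, hGp, fun x hx => mem_ball_zero_iff.2 ?_⟩
  exact norm_lt_one_of_norm_le_one hU hUc hGd
    (fun y hy => le_of_tendsto (hG.tendsto_at hy).norm (hbd y hy)) hp hGp x hx

/-- Limits of inverse charts that are nondegenerate at one point are locally biholomorphic and
injective. -/
theorem det_ne_zero_and_injOn_of_tendsto {ι : Type*} {l : Filter ι} [l.NeBot]
    {u : ι → Cn n → Cn n} {f : Cn n → Cn n} {U : Set (Cn n)} {W : ι → Set (Cn n)} (hU : IsOpen U)
    (hUc : IsPreconnected U) (hu : EventuallyHolomorphicOn l u U)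
    (h : TendstoLocallyUniformlyOn u f l U)
    (hW : ∀ x ∈ U, ∃ δ > 0, ∀ᶠ k in l, ball x δ ⊆ W k)
    (hne : ∀ k, ∀ y ∈ W k, (fderiv ℂ (u k) y).det ≠ 0) (hinj : ∀ k, InjOn (u k) (W k))
    {p : Cn n} (hp : p ∈ U) (hdet : (fderiv ℂ f p).det ≠ 0) :
    (∀ x ∈ U, (fderiv ℂ f x).det ≠ 0) ∧ InjOn f U := by
  have h1 : ∀ x ∈ U, (fderiv ℂ f x).det ≠ 0 :=
    det_fderiv_ne_zero_of_tendsto hU hUc hu h (fun x hx => by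
      obtain ⟨δ, hδ, hk⟩ := hW x hx
      exact ⟨δ, hδ, hk.mono fun k hk y hy => hne k y (hk hy)⟩) hp hdet
  refine ⟨h1, injOn_of_tendstoLocallyUniformlyOn hU hu h h1 fun x hx y hy => ?_⟩
  obtain ⟨δ, hδ, hk⟩ := hW x hx
  obtain ⟨δ', hδ', hk'⟩ := hW y hy
  refine ⟨min δ δ', lt_min hδ hδ', ?_⟩
  filter_upwards [hk, hk'] with k hk hk'
  exact (hinj k).mono (union_subset ((ball_subset_ball (min_le_left _ _)).trans hk)
    ((ball_subset_ball (min_le_right _ _)).trans hk'))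

/-- The bound `m` lies strictly between the distance of `x` and the eventual radii, so one open
Bergman ball about `p` serves all large `k`. -/
theorem eventually_ball_subset_of_radii {X : Set (Cn n)} (hX : IsOpen X)
    (hXc : IsPreconnected X) (hpos : ∀ z ∈ X, 0 < (bergmanKernel X z z).re) {ι : Type*}
    {l : Filter ι} {W : ι → Set (Cn n)} {r : ι → ℝ} {p : Cn n} (hp : p ∈ X)
    (hW : ∀ k, bergmanBall X p (r k) ⊆ W k) {x : Cn n} (hx : x ∈ X) {m : ℝ}
    (hm : bergmanDist X p x < m) (hr : ∀ᶠ k in l, m ≤ r k) :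
    ∃ δ > 0, ∀ᶠ k in l, ball x δ ⊆ W k := by
  obtain ⟨δ, hδ, hsub⟩ := Metric.mem_nhds_iff.1
    ((isOpen_bergmanBall hX hXc hpos hp m).mem_nhds ⟨hx, hm⟩)
  refine ⟨δ, hδ, hr.mono fun k hk y hy => hW k ⟨(hsub hy).1, (hsub hy).2.trans_le hk⟩⟩

theorem IsBallChart.injOn {X : Set (Cn n)} {f g : Cn n → Cn n} {W : Set (Cn n)}
    (h : IsBallChart X f g W) : InjOn f (unitBall n) :=
  LeftInvOn.injOn h.left_inv

theorem IsBallChart.injOn_inv {X : Set (Cn n)} {f g : Cn n → Cn n} {W : Set (Cn n)}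
    (h : IsBallChart X f g W) : InjOn g W :=
  LeftInvOn.injOn h.right_inv

theorem isBallChart_of_bijOn {X : Set (Cn n)} (hX : IsOpen X) {G : Cn n → Cn n}
    (hG : DifferentiableOn ℂ G X) (hdet : ∀ x ∈ X, (fderiv ℂ G x).det ≠ 0)
    (hbij : BijOn G X (unitBall n)) : IsBallChart X (Function.invFunOn G X) G X := by
  have h1 := differentiableOn_invFunOn hX hG hdet hbij.injOn
  rw [hbij.image_eq] at h1
  have h2 := hbij.invOn_invFunOn
  exact ⟨hX, Subset.rfl, h1.2, hG, hbij.surjOn.mapsTo_invFunOn, hbij.mapsTo, h2.2, h2.1⟩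

/-- A domain exhausted by charts centred at one point is biholomorphic to the ball. -/
theorem exists_isBallChart_univ {X : Set (Cn n)} (hX : IsOpen X) (hXc : IsPreconnected X)
    {p : Cn n} (hp : p ∈ X) (hpos : 0 < (bergmanKernel X p p).re)
    {f g : ℕ → Cn n → Cn n} {W : ℕ → Set (Cn n)} (h : ∀ k, IsBallChart X (f k) (g k) (W k))
    (h0 : ∀ k, f k 0 = p) (hW : ∀ x ∈ X, ∃ δ > 0, ∀ᶠ k in atTop, ball x δ ⊆ W k) :
    ∃ F G, IsBallChart X F G X := by
  set l : Ultrafilter ℕ := hyperfilter ℕ with hl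
  have hlt : (l : Filter ℕ) ≤ atTop := Nat.hyperfilter_le_atTop
  have hWl : ∀ x ∈ X, ∃ δ > 0, ∀ᶠ k in (l : Filter ℕ), ball x δ ⊆ W k := fun x hx => by
    obtain ⟨δ, hδ, hk⟩ := hW x hx
    exact ⟨δ, hδ, hlt hk⟩
  obtain ⟨hhol, G, hG, hGd, hGp, hGm⟩ := exists_tendsto_chart_inverse l h h0 hX hXc hp hWl
  -- Positivity of the kernel at `p` supplies `φ` with `φ p ≠ 0`, and the Jacobian bound for the
  -- charts, which is uniform in `k`, survives in the limit.
  have hdet : (fderiv ℂ G p).det ≠ 0 := by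
    intro hdet
    obtain ⟨φ, hφ, hφp, hφT⟩ := exists_holomorphic_ne_zero hpos
    have h1 := (tendstoLocallyUniformlyOn_det_fderiv hX hhol hG).tendsto_at hp
    have h2 : Tendsto (fun k => (∫⁻ y in X, ‖φ y‖ₑ ^ 2) * ‖(fderiv ℂ (g k) p).det‖ₑ ^ 2) l
        (𝓝 ((∫⁻ y in X, ‖φ y‖ₑ ^ 2) * ‖(fderiv ℂ G p).det‖ₑ ^ 2)) :=
      ENNReal.Tendsto.const_mul (ENNReal.Tendsto.pow h1.enorm) (Or.inr hφT)
    have h3 := ge_of_tendsto' h2 fun k => by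
      have := (h k).enorm_sq_mul_volume_le hφ
      rw [h0 k] at this
      exact this
    rw [hdet, enorm_zero, zero_pow two_ne_zero, mul_zero, nonpos_iff_eq_zero, mul_eq_zero] at h3
    rcases h3 with h3 | h3
    · exact hφp (by simpa using h3)
    · exact (measure_ball_pos volume (0 : Cn n) one_pos).ne' h3
  obtain ⟨hdetX, hinj⟩ := det_ne_zero_and_injOn_of_tendsto hX hXc hhol hG hWl
    (fun k y hy => (h k).det_inv_ne_zero hy) (fun k => (h k).injOn_inv) hp hdet
  have hfX : ∀ k, MapsTo (f k) (unitBall n) X := fun k z hz => (h k).subset ((h k).mapsTo hz)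
  have hvd : ∀ k, DifferentiableOn ℂ (fun z => G (f k z)) (unitBall n) := fun k =>
    hGd.comp (h k).differentiableOn (hfX k)
  have hball : ∀ z ∈ unitBall n, ∃ δ > 0, ball z δ ⊆ unitBall n := fun z hz =>
    Metric.isOpen_iff.1 isOpen_ball z hz
  obtain ⟨F, hF⟩ := exists_tendstoLocallyUniformlyOn_of_bounded l
    (u := fun k z => G (f k z)) (U := unitBall n) isOpen_ball fun z hz => by
      obtain ⟨δ, hδ, hs⟩ := hball z hz
      exact ⟨δ, hδ, 1, Eventually.of_forall fun k => ⟨(hvd k).mono hs, fun y hy =>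
        (mem_ball_zero_iff.1 (hGm (hfX k (hs hy)))).le⟩⟩
  have hvhol : EventuallyHolomorphicOn (l : Filter ℕ) (fun k z => G (f k z)) (unitBall n) :=
    fun z hz => by
      obtain ⟨δ, hδ, hs⟩ := hball z hz
      exact ⟨δ, hδ, Eventually.of_forall fun k => (hvd k).mono hs⟩
  have hFd := differentiableOn_of_tendstoLocallyUniformlyOn isOpen_ball hvhol hF
  -- Evaluate `G ∘ f k` at the moving points `g k x → G x`: its value there is `G x` exactly.
  have hFG : ∀ x ∈ X, F (G x) = G x := fun x hx => by
    obtain ⟨δ, hδ, hk⟩ := hWl x hx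
    have hgx : Tendsto (fun k => g k x) l (𝓝[unitBall n] (G x)) :=
      tendsto_nhdsWithin_iff.2 ⟨hG.tendsto_at hx, hk.mono fun k hk =>
        (h k).mapsTo_inv (hk (mem_ball_self hδ))⟩
    refine tendsto_nhds_unique (hF.tendsto_comp (hFd.continuousOn _ (hGm hx)) (hGm hx) hgx) ?_
    refine tendsto_const_nhds.congr' ?_
    filter_upwards [hk] with k hk
    rw [(h k).right_inv x (hk (mem_ball_self hδ))]
  -- `F` fixes the image of `G`, a neighbourhood of `0` since `G` is nondegenerate at `p`; the
  -- identity theorem does the rest.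
  have hid : ∀ z ∈ unitBall n, F z - z = 0 := by
    refine eqOn_zero_ball_of_eventuallyEq (hFd.sub differentiableOn_id) ?_
    have := image_mem_nhds_of_det_ne_zero hX hGd hp hdet
    rw [hGp] at this
    filter_upwards [this]
    rintro _ ⟨x, hx, rfl⟩
    simp [hFG x hx]
  have hsurj : SurjOn G X (unitBall n) := by
    intro b hb
    obtain ⟨δ, hδ, hs⟩ := hball b hb
    have hFb : F =ᶠ[𝓝 b] id := by
      filter_upwards [isOpen_ball.mem_nhds hb] with z hz
      exact sub_eq_zero.1 (hid z hz)
    have hdF : (fderiv ℂ F b).det ≠ 0 := by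
      rw [hFb.fderiv_eq, fderiv_id]
      simp [ContinuousLinearMap.det]
    -- As the maps `G ∘ f k` converge to the identity, one of them attains `b`, and so does `G`.
    obtain ⟨k, z, hz, hkz⟩ :=
      (eventually_mem_image_ball isOpen_ball hvhol hF hb hdF hδ).exists
    exact ⟨f k z, hfX k (hs hz), hkz.trans (sub_eq_zero.1 (hid b hb))⟩
  exact ⟨_, G, isBallChart_of_bijOn hX hGd hdetX ⟨hGm, hinj, hsurj⟩⟩

end Limits

/-! ### Limits of charts in taut domains. -/

section Taut

open Metric

variable {n : ℕ}

/-- Tautness concerns discs, so `F j` is restricted to the disc `t ↦ (t / ρ) • z j`, which reaches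
`z j` at `t = ρ`. All these discs pass through `p` at `t = 0`, which excludes compact divergence. -/
theorem IsTaut.exists_subseq_tendsto {X : Set (Cn n)} (hT : IsTaut X) {F : ℕ → Cn n → Cn n}
    (hF : ∀ j, DifferentiableOn ℂ (F j) (unitBall n)) (hFX : ∀ j, MapsTo (F j) (unitBall n) X)
    {p : Cn n} (hp : p ∈ X) (h0 : ∀ j, F j 0 = p) {ρ : ℝ} (hρ : 0 < ρ) (hρ1 : ρ < 1)
    {z : ℕ → Cn n} (hz : ∀ j, ‖z j‖ ≤ ρ) :
    ∃ s : ℕ → ℕ, StrictMono s ∧ ∃ y ∈ X, Tendsto (fun j => F (s j) (z (s j))) atTop (𝓝 y) := by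
  have hρC : (ρ : ℂ) ≠ 0 := by exact_mod_cast hρ.ne'
  have hm : ∀ j, MapsTo (fun t : ℂ => (t / ρ) • z j) (ball 0 1) (unitBall n) := fun j t ht => by
    rw [mem_ball_zero_iff] at ht ⊢
    rw [norm_smul, norm_div, Complex.norm_real, Real.norm_of_nonneg hρ.le]
    calc ‖t‖ / ρ * ‖z j‖ ≤ ‖t‖ / ρ * ρ := by gcongr; exact hz j
      _ = ‖t‖ := div_mul_cancel₀ _ hρ.ne'
      _ < 1 := ht
  obtain ⟨s, hs, ⟨g, -, hgX, hg⟩ | hdiv⟩ := hT (fun j t => F j ((t / ρ) • z j)) fun j =>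
    ⟨(hF j).comp (by fun_prop) (hm j), (hFX j).comp (hm j)⟩
  · have hρB : (ρ : ℂ) ∈ ball (0 : ℂ) 1 := by
      rwa [mem_ball_zero_iff, Complex.norm_real, Real.norm_of_nonneg hρ.le]
    refine ⟨s, hs, g ρ, hgX hρB, ?_⟩
    simpa [div_self hρC] using hg.tendsto_at hρB
  · obtain ⟨k, hk⟩ := (hdiv {0} (by simp) isCompact_singleton {p} (by simpa using hp)
      isCompact_singleton).exists
    simp [h0] at hk

/-- This is the input to Montel's theorem for the charts themselves, as `X` need not be bounded.
Unbounded values would contradict the convergence of a subsequence. -/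
theorem IsTaut.exists_norm_le {X : Set (Cn n)} (hT : IsTaut X) {F : ℕ → Cn n → Cn n}
    (hF : ∀ j, DifferentiableOn ℂ (F j) (unitBall n)) (hFX : ∀ j, MapsTo (F j) (unitBall n) X)
    {p : Cn n} (hp : p ∈ X) (h0 : ∀ j, F j 0 = p) {ρ : ℝ} (hρ : 0 < ρ) (hρ1 : ρ < 1) :
    ∃ M : ℝ, ∀ k, ∀ z ∈ closedBall (0 : Cn n) ρ, ‖F k z‖ ≤ M := by
  by_contra! hcon
  choose k z hz hk using fun j : ℕ => hcon j
  obtain ⟨s, hs, y, -, hy⟩ := hT.exists_subseq_tendsto (fun j => hF (k j)) (fun j => hFX (k j)) hp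
    (fun j => h0 (k j)) hρ hρ1 fun j => mem_closedBall_zero_iff.1 (hz j)
  have h1 : Tendsto (fun j => ((s j : ℕ) : ℝ)) atTop atTop :=
    tendsto_natCast_atTop_atTop.comp hs.tendsto_atTop
  exact not_tendsto_nhds_of_tendsto_atTop
    (tendsto_atTop_mono (fun j => (hk (s j)).le) h1) _ hy.norm

theorem IsTaut.mem_of_tendsto {X : Set (Cn n)} (hT : IsTaut X) {F : ℕ → Cn n → Cn n}
    (hF : ∀ j, DifferentiableOn ℂ (F j) (unitBall n)) (hFX : ∀ j, MapsTo (F j) (unitBall n) X)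
    {p : Cn n} (hp : p ∈ X) (h0 : ∀ j, F j 0 = p) {l : Filter ℕ} [l.NeBot] {z y : Cn n}
    (hz : z ∈ unitBall n) (hy : Tendsto (fun k => F k z) l (𝓝 y)) : y ∈ X := by
  have hz1 : ‖z‖ < 1 := mem_ball_zero_iff.1 hz
  have hk : ∀ j : ℕ, ∃ k, dist (F k z) y < 1 / ((j : ℝ) + 1) := fun j =>
    (hy.eventually (ball_mem_nhds y Nat.one_div_pos_of_nat)).exists
  choose k hk using hk
  have hlim : Tendsto (fun j => F (k j) z) atTop (𝓝 y) :=
    tendsto_iff_dist_tendsto_zero.2 (squeeze_zero (fun _ => dist_nonneg) (fun j => (hk j).le)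
      tendsto_one_div_add_atTop_nhds_zero_nat)
  obtain ⟨s, hs, y', hy', hlim'⟩ := hT.exists_subseq_tendsto (fun j => hF (k j))
    (fun j => hFX (k j)) hp (fun j => h0 (k j)) (ρ := (1 + ‖z‖) / 2)
    (by linarith [norm_nonneg z]) (by linarith) (z := fun _ => z) fun _ => by linarith
  rwa [tendsto_nhds_unique (hlim.comp hs.tendsto_atTop) hlim']

/-- In a taut domain, centred charts subconverge to a chart whose image contains every domain that
the images of the charts exhaust. -/
theorem IsTaut.exists_isHolEmbedding {X : Set (Cn n)} (hT : IsTaut X) {p : Cn n} (hp : p ∈ X)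
    {f g : ℕ → Cn n → Cn n} {W : ℕ → Set (Cn n)} (h : ∀ k, IsBallChart X (f k) (g k) (W k))
    (h0 : ∀ k, f k 0 = p) {U : Set (Cn n)} (hU : IsOpen U) (hUc : IsPreconnected U) (hpU : p ∈ U)
    (hW : ∀ x ∈ U, ∃ δ > 0, ∀ᶠ k in atTop, ball x δ ⊆ W k) :
    ∃ F, IsHolEmbedding F (unitBall n) X ∧ U ⊆ F '' unitBall n := by
  set l : Ultrafilter ℕ := hyperfilter ℕ with hl
  have hlt : (l : Filter ℕ) ≤ atTop := Nat.hyperfilter_le_atTop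
  have hWl : ∀ x ∈ U, ∃ δ > 0, ∀ᶠ k in (l : Filter ℕ), ball x δ ⊆ W k := fun x hx => by
    obtain ⟨δ, hδ, hk⟩ := hW x hx
    exact ⟨δ, hδ, hlt hk⟩
  obtain ⟨-, G, hG, hGd, hGp, hGm⟩ := exists_tendsto_chart_inverse l h h0 hU hUc hpU hWl
  have hfd := fun k => (h k).differentiableOn
  have hfX : ∀ k, MapsTo (f k) (unitBall n) X := fun k z hz => (h k).subset ((h k).mapsTo hz)
  have hball : ∀ z ∈ unitBall n, ∃ δ > 0, ∀ᶠ k in (l : Filter ℕ), ball z δ ⊆ unitBall n :=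
    fun z hz => by
      obtain ⟨δ, hδ, hs⟩ := Metric.isOpen_iff.1 isOpen_ball z hz
      exact ⟨δ, hδ, Eventually.of_forall fun _ => hs⟩
  have hfhol : EventuallyHolomorphicOn (l : Filter ℕ) f (unitBall n) := fun z hz => by
    obtain ⟨δ, hδ, hs⟩ := hball z hz
    exact ⟨δ, hδ, hs.mono fun k hs => (hfd k).mono hs⟩
  obtain ⟨F, hF⟩ := exists_tendstoLocallyUniformlyOn_of_bounded l (u := f) (U := unitBall n)
    isOpen_ball fun z hz => by
      have hz1 : ‖z‖ < 1 := mem_ball_zero_iff.1 hz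
      obtain ⟨M, hM⟩ := hT.exists_norm_le hfd hfX hp h0 (ρ := (1 + ‖z‖) / 2)
        (by linarith [norm_nonneg z]) (by linarith)
      have hs : ball z ((1 - ‖z‖) / 2) ⊆ closedBall 0 ((1 + ‖z‖) / 2) := fun y hy => by
        rw [mem_ball, dist_eq_norm] at hy
        rw [mem_closedBall_zero_iff]
        linarith [norm_le_norm_add_norm_sub' y z]
      exact ⟨(1 - ‖z‖) / 2, by linarith, M, Eventually.of_forall fun k =>
        ⟨(hfd k).mono (hs.trans (closedBall_subset_ball (by linarith))),
          fun y hy => hM k y (hs hy)⟩⟩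
  have hFd := differentiableOn_of_tendstoLocallyUniformlyOn isOpen_ball hfhol hF
  have hFX : MapsTo F (unitBall n) X := fun z hz =>
    hT.mem_of_tendsto hfd hfX hp h0 hz (hF.tendsto_at hz)
  have hFG : ∀ x ∈ U, F (G x) = x := fun x hx => by
    obtain ⟨δ, hδ, hk⟩ := hWl x hx
    have hgx : Tendsto (fun k => g k x) l (𝓝[unitBall n] (G x)) :=
      tendsto_nhdsWithin_iff.2 ⟨hG.tendsto_at hx, hk.mono fun k hk =>
        (h k).mapsTo_inv (hk (mem_ball_self hδ))⟩
    refine tendsto_nhds_unique (hF.tendsto_comp (hFd.continuousOn _ (hGm hx)) (hGm hx) hgx) ?_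
    refine tendsto_const_nhds.congr' ?_
    filter_upwards [hk] with k hk
    rw [(h k).right_inv x (hk (mem_ball_self hδ))]
  -- Nondegeneracy at the centre is free here: `F ∘ G` is the identity near `p`.
  have hdet : (fderiv ℂ F (G p)).det ≠ 0 :=
    left_ne_zero_of_mul_eq_one (det_mul_det_eq_one ((hGd p hpU).differentiableAt (hU.mem_nhds hpU))
      ((hFd _ (hGm hpU)).differentiableAt (isOpen_ball.mem_nhds (hGm hpU)))
      (by filter_upwards [hU.mem_nhds hpU] with x hx using hFG x hx))
  obtain ⟨hdetB, hinj⟩ := det_ne_zero_and_injOn_of_tendsto isOpen_ball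
    (convex_ball (0 : Cn n) 1).isPreconnected hfhol hF hball
    (fun k y hy => (h k).det_ne_zero hy) (fun k => (h k).injOn) (hGm hpU) hdet
  obtain ⟨h1, h2⟩ := differentiableOn_invFunOn isOpen_ball hFd hdetB hinj
  exact ⟨F, ⟨hFd, hFX, h1, _, h2, hinj.leftInvOn_invFunOn⟩, fun x hx => ⟨G x, hGm hx, hFG x hx⟩⟩

end Taut

/-! ### The invariant: vanishing, attained radius, continuity. -/

section Invariant

open Metric

variable {n : ℕ} {X : Set (Cn n)} {p q : Cn n}

theorem bddBelow_one_div_fridmanRadii :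
    BddBelow ((fun r : ℝ => 1 / r) '' fridmanRadii X p) := by
  refine ⟨0, ?_⟩
  rintro _ ⟨r, hr, rfl⟩
  exact (one_div_pos.2 hr.1).le

theorem fridmanInvariant_nonneg : 0 ≤ fridmanInvariant X p := by
  refine Real.sInf_nonneg ?_
  rintro _ ⟨r, hr, rfl⟩
  exact (one_div_pos.2 hr.1).le

theorem fridmanInvariant_le {r : ℝ} (hr : r ∈ fridmanRadii X p) : fridmanInvariant X p ≤ 1 / r :=
  csInf_le bddBelow_one_div_fridmanRadii (mem_image_of_mem _ hr)

theorem exists_mem_fridmanRadii_of_lt (hne : (fridmanRadii X p).Nonempty) {c : ℝ}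
    (hc : 0 < c) (h : fridmanInvariant X p < 1 / c) : ∃ r ∈ fridmanRadii X p, c < r := by
  obtain ⟨_, ⟨r, hr, rfl⟩, hlt⟩ := exists_lt_of_csInf_lt (hne.image _) h
  exact ⟨r, hr, (one_div_lt_one_div hr.1 hc).1 hlt⟩

theorem IsBallChart.fridmanInvariant_eq_zero {f g : Cn n → Cn n} (h : IsBallChart X f g X)
    (x : Cn n) : fridmanInvariant X x = 0 := by
  refine le_antisymm (le_of_forall_pos_le_add fun ε hε => ?_) fridmanInvariant_nonneg
  have := fridmanInvariant_le (h.mem_fridmanRadii (p := x) (one_div_pos.2 hε) fun w hw => hw.1)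
  rwa [one_div_one_div, ← zero_add ε] at this

theorem IsBallChart.biholomorphic {f g : Cn n → Cn n} (h : IsBallChart X f g X) :
    Biholomorphic X (unitBall n) :=
  ⟨g, f, h.differentiableOn_inv, h.differentiableOn, h.mapsTo_inv, h.mapsTo, h.right_inv,
    h.left_inv⟩

/-- Vanishing means that there are admissible radii `r k > k + 1`, so the Bergman balls, and with
them the charts, exhaust `X`. -/
theorem exists_isBallChart_of_fridmanInvariant_eq_zero (hX : IsOpen X) (hXc : IsPreconnected X)
    (hd : BergmanDistIsDistance X) (hp : p ∈ X) (h : fridmanInvariant X p = 0) :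
    ∃ f g, IsBallChart X f g X := by
  have hr : ∀ k : ℕ, ∃ r ∈ fridmanRadii X p, (k : ℝ) + 1 < r := fun k =>
    exists_mem_fridmanRadii_of_lt (fridmanRadii_nonempty hX hXc hd hp) (by positivity)
      (by rw [h]; positivity)
  choose r hr hkr using hr
  choose f g W hc h0 hW using fun k => exists_centered_chart hp (hr k)
  refine exists_isBallChart_univ hX hXc hp (hd.kernel_pos p hp) hc h0 fun x hx =>
    eventually_ball_subset_of_radii hX hXc hd.kernel_pos hp hW hx (lt_add_one _) ?_
  obtain ⟨N, hN⟩ := exists_nat_ge (bergmanDist X p x)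
  filter_upwards [eventually_ge_atTop N] with k hk
  have : (N : ℝ) ≤ k := by exact_mod_cast hk
  linarith [hkr k]

/-- Along a minimizing sequence the radii eventually exceed every `m < 1 / h_X(p)`, so the charts
exhaust the open Bergman ball of the critical radius. -/
theorem IsTaut.exists_isHolEmbedding_bergmanBall (hT : IsTaut X) (hX : IsOpen X)
    (hXc : IsPreconnected X) (hd : BergmanDistIsDistance X) (hp : p ∈ X)
    (h : 0 < fridmanInvariant X p) :
    ∃ F, IsHolEmbedding F (unitBall n) X ∧
      bergmanBall X p (1 / fridmanInvariant X p) ⊆ F '' unitBall n := by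
  obtain ⟨u, -, hu, hmem⟩ := exists_seq_tendsto_sInf
    ((fridmanRadii_nonempty hX hXc hd hp).image fun r : ℝ => 1 / r) bddBelow_one_div_fridmanRadii
  choose r hr hru using hmem
  choose f g W hc h0 hW using fun k => exists_centered_chart hp (hr k)
  refine hT.exists_isHolEmbedding hp hc h0 (isOpen_bergmanBall hX hXc hd.kernel_pos hp _)
    (isPreconnected_bergmanBall hX hXc hd.kernel_pos hp _)
    (mem_bergmanBall_self hp (one_div_pos.2 h)) fun x hx => ?_
  obtain ⟨m, hm, hmh⟩ := exists_between hx.2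
  have hm0 : 0 < m := (bergmanDist_nonneg _ _).trans_lt hm
  refine eventually_ball_subset_of_radii hX hXc hd.kernel_pos hp hW hx.1 hm ?_
  filter_upwards [hu.eventually_lt_const ((lt_one_div hm0 h).1 hmh)] with k hk
  rw [← hru k] at hk
  exact ((one_div_lt_one_div (hr k).1 hm0).1 hk).le

/-- The same embedding serves both centres, since `B_X(q, r - d_X(p, q))` lies in `B_X(p, r)`. -/
theorem sub_bergmanDist_mem_fridmanRadii (hX : IsOpen X) (hXc : IsPreconnected X)
    (hd : BergmanDistIsDistance X) (hp : p ∈ X) (hq : q ∈ X) {r : ℝ} (hr : r ∈ fridmanRadii X p)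
    (hlt : bergmanDist X p q < r) : r - bergmanDist X p q ∈ fridmanRadii X q := by
  obtain ⟨-, f, hf, hsub⟩ := hr
  refine ⟨sub_pos.2 hlt, f, hf, fun w hw => hsub ⟨hw.1, ?_⟩⟩
  linarith [hw.2, bergmanDist_triangle hX hXc hd.kernel_pos hp hq hw.1]

/-- `1 / h_X` is the supremum of the admissible radii, and moving the centre from `p` to `q` costs
at most `d_X(p, q)` of radius. -/
theorem one_div_fridmanInvariant_le (hX : IsOpen X) (hXc : IsPreconnected X)
    (hd : BergmanDistIsDistance X) (hp : p ∈ X) (hq : q ∈ X) (hp0 : 0 < fridmanInvariant X p)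
    (hq0 : 0 < fridmanInvariant X q) :
    1 / fridmanInvariant X p ≤ 1 / fridmanInvariant X q + bergmanDist X p q := by
  by_contra! hlt
  have hc : 0 < 1 / fridmanInvariant X q + bergmanDist X p q :=
    add_pos_of_pos_of_nonneg (one_div_pos.2 hq0) (bergmanDist_nonneg _ _)
  obtain ⟨r, hr, hcr⟩ := exists_mem_fridmanRadii_of_lt (fridmanRadii_nonempty hX hXc hd hp) hc
    ((lt_one_div hc hp0).1 hlt)
  have h1 := fridmanInvariant_le (sub_bergmanDist_mem_fridmanRadii hX hXc hd hp hq hr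
    (by linarith [one_div_pos.2 hq0]))
  have h2 : 1 / fridmanInvariant X q < r - bergmanDist X p q := by linarith
  have h3 := (one_div_lt hq0 ((one_div_pos.2 hq0).trans h2)).1 h2
  exact absurd h1 (not_le.2 h3)

theorem continuousOn_fridmanInvariant (hX : IsOpen X) (hXc : IsPreconnected X)
    (hd : BergmanDistIsDistance X) (hpos : ∀ x ∈ X, 0 < fridmanInvariant X x) :
    ContinuousOn (fridmanInvariant X) X := by
  have h1 : ContinuousOn (fun x => 1 / fridmanInvariant X x) X := by
    intro p hp
    have h2 : Tendsto (bergmanDist X p) (𝓝[X] p) (𝓝 0) := by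
      have := continuousOn_bergmanDist hX hXc hd.kernel_pos hp p hp
      rwa [ContinuousWithinAt, bergmanDist_self hp] at this
    refine tendsto_iff_dist_tendsto_zero.2 (squeeze_zero' (Eventually.of_forall fun _ =>
      dist_nonneg) ?_ h2)
    filter_upwards [self_mem_nhdsWithin] with q hq
    have h3 := one_div_fridmanInvariant_le hX hXc hd hp hq (hpos p hp) (hpos q hq)
    have h4 := one_div_fridmanInvariant_le hX hXc hd hq hp (hpos q hq) (hpos p hp)
    rw [bergmanDist_comm hX hXc hd.kernel_pos hq hp] at h4
    rw [Real.dist_eq, abs_sub_le_iff]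
    constructor <;> linarith
  refine (h1.inv₀ fun x hx => (one_div_pos.2 (hpos x hx)).ne').congr fun x _ => ?_
  simp

end Invariant

end BergmanFridman

theorem theorem2p2 {n : ℕ} (X : Set (Cn n)) (hXo : IsOpen X) (hXc : IsConnected X)
    (hd : BergmanDistIsDistance X) :
    (∀ x ∈ X, (fridmanRadii X x).Nonempty) ∧
    ((∃ x₀ ∈ X, fridmanInvariant X x₀ = 0) →
      Biholomorphic X (unitBall n) ∧ ∀ x ∈ X, fridmanInvariant X x = 0) ∧
    (IsTaut X → ∀ x₀ ∈ X, 0 < fridmanInvariant X x₀ →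
      ∃ F : Cn n → Cn n, IsHolEmbedding F (unitBall n) X ∧
        bergmanBall X x₀ (1 / fridmanInvariant X x₀) ⊆ F '' unitBall n) ∧
    ContinuousOn (fridmanInvariant X) X := by
  have hXp := hXc.isPreconnected
  refine ⟨fun x hx => fridmanRadii_nonempty hXo hXp hd hx, ?_, fun hT x₀ hx₀ h =>
    hT.exists_isHolEmbedding_bergmanBall hXo hXp hd hx₀ h, ?_⟩
  · rintro ⟨x₀, hx₀, h0⟩
    obtain ⟨f, g, h⟩ := exists_isBallChart_of_fridmanInvariant_eq_zero hXo hXp hd hx₀ h0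
    exact ⟨h.biholomorphic, fun x _ => h.fridmanInvariant_eq_zero x⟩
  -- A single zero makes the invariant constant; otherwise it is positive everywhere and its
  -- reciprocal is continuous.
  · by_cases h : ∃ x₀ ∈ X, fridmanInvariant X x₀ = 0
    · obtain ⟨x₀, hx₀, h0⟩ := h
      obtain ⟨f, g, h⟩ := exists_isBallChart_of_fridmanInvariant_eq_zero hXo hXp hd hx₀ h0
      exact continuousOn_const.congr fun x _ => h.fridmanInvariant_eq_zero x
    · push Not at h
      exact continuousOn_fridmanInvariant hXo hXp hd fun x hx =>
        lt_of_le_of_ne fridmanInvariant_nonneg (h x hx).symm
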